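/- All graphs are finite, simple and undirected. For a connected graph $G=(V,E)$ with boundary $\delta\Omega\subseteq V$, a Steklov eigenvalue of $(G,\delta\Omega)$ is a real $\lambda$ for which there is $f\neq 0$ in $\mathbb{R}^V$ with $\sum_{y\sim x}(f(x)-f(y))=0$ for $x\in V\setminus\delta\Omega$ and $\sum_{y\sim x}(f(x)-f(y))=\lambda f(x)$ for $x\in\delta\Omega$; $\lambda_2(G,\delta\Omega)$ denotes the second smallest one, counted with multiplicity (it is defined when $|\delta\Omega|\ge 2$). A connected graph $G$ is fully triangulated if it is embedded in a closed orientable surface (of any genus) so that every face is a triangle and no two faces have the same three vertices (i.e. $G\neq K_3$). Its hexagon subdivision is obtained by adding the midpoint of every edge as a new vertex and cutting each triangular face into four triangles along the three segments joining the midpoints of its sides; $G^{(k)}$ is the graph obtained after $k$ such steps, so $G^{(0)}=G$. A graph $H$ contains $G$ as a $(\xi,\ell)$-immersion if, for some injective map $\pi:V(G)\to V(H)$, $H$ is obtained from the copy of $G$ on $\pi(V(G))$ by replacing each edge $\{u,v\}$ of $G$ with a path in $H$ of length at most $\ell$ from $\pi(u)$ to $\pi(v)$, so that each edge of $H$ is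 used by at most $\xi$ of these paths and $H$ has no other vertices or edges. Lemma. For every $D$ there are real constants $c>0$ and $C$ and natural numbers $\xi$ and $L$, depending only on $D$, such that the following holds for every fully triangulated graph $G$ of maximum degree at most $D$, every non-empty boundary $\delta\Omega\subseteq V(G)$ and every integer $k\ge 0$. There are a boundary set $\delta\Omega^{(k)}\subseteq V(G^{(k)})$ with $$c\,4^k|\delta\Omega|\le|\delta\Omega^{(k)}|\le C\,4^k|\delta\Omega|,$$ and a subgraph $H$ of $G^{(k)}$ that contains $G$ as a $(\xi,L\,2^k)$-immersion, with vertex map $\pi$, such that, if $|\delta\Omega|\ge 2$, $$\lambda_2(H,\pi(\delta\Omega))\le C\,2^k\,\lambda_2(G^{(k)},\delta\Omega^{(k)}).$$ -/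

import Mathlib

/-- A triangulation of a connected closed orientable surface whose 1-skeleton is the simple graph
`G`, given combinatorially (as a rotation system all of whose faces are triangles).
`face a b c` says that `a, b, c` are, in counterclockwise order, the vertices of a face; in other
words, `c` is the neighbour of `a` that follows `b` in the rotation at `a`. -/
structure SurfaceTriangulation {V : Type*} (G : SimpleGraph V) where
  face : V → V → V → Prop
  face_rotate : ∀ {a b c : V}, face a b c → face b c a
  adj_of_face : ∀ {a b c : V}, face a b c → G.Adj a b
  /-- Exactly one face lies to the left of every directed edge. -/
  existsUnique_face : ∀ {a b : V}, G.Adj a b → ∃! c, face a b c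
  /-- The faces around a vertex form a single cycle. -/
  link_cyclic : ∀ {a b b' : V}, G.Adj a b → G.Adj a b' →
    Relation.ReflTransGen (fun x y => face a x y) b b'
  /-- Three vertices span at most one face. -/
  face_asymm : ∀ {a b c : V}, face a b c → ¬ face a c b
  connected : G.Connected
  nontrivial : Nontrivial V

namespace SurfaceTriangulation

variable {V : Type*} {G : SimpleGraph V}

open Classical in
/-- The faces of the `k`-fold hexagon subdivision, as (counterclockwise) triangles in the geometric
realization of the triangulation in `ℝ^V`, in which a vertex `a` of `G` is the unit vector `e_a`.
One subdivision step cuts each triangle `p q r` along the segments between the midpoints of its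
sides into three corner triangles and one central triangle. -/
inductive HexFace (T : SurfaceTriangulation G) : ℕ → (V → ℝ) → (V → ℝ) → (V → ℝ) → Prop
  | base {a b c : V} : T.face a b c →
      HexFace T 0 (Pi.single a 1) (Pi.single b 1) (Pi.single c 1)
  | rotate {k : ℕ} {p q r : V → ℝ} : HexFace T k p q r → HexFace T k q r p
  | corner {k : ℕ} {p q r : V → ℝ} : HexFace T k p q r →
      HexFace T (k + 1) p (midpoint ℝ p q) (midpoint ℝ p r)
  | center {k : ℕ} {p q r : V → ℝ} : HexFace T k p q r →
      HexFace T (k + 1) (midpoint ℝ p q) (midpoint ℝ q r) (midpoint ℝ r p)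

/-- The vertices of the `k`-fold hexagon subdivision: the corners of its faces. -/
def HexVertex (T : SurfaceTriangulation G) (k : ℕ) : Type _ :=
  {p : V → ℝ // ∃ q r, T.HexFace k p q r}

/-- The `k`-fold hexagon subdivision of `G`: two vertices are adjacent when they span a side of a
face. -/
def hexGraph (T : SurfaceTriangulation G) (k : ℕ) : SimpleGraph (T.HexVertex k) :=
  SimpleGraph.fromRel (fun p q => ∃ r, T.HexFace k p.1 q.1 r)

theorem exists_finite_hexFace [Finite V] (T : SurfaceTriangulation G) (k : ℕ) :
    ∃ S : Set (V → ℝ), S.Finite ∧ ∀ p q r, T.HexFace k p q r → p ∈ S ∧ q ∈ S ∧ r ∈ S := by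
  classical
  let S : ℕ → Set (V → ℝ) := fun k =>
    Nat.rec (Set.range fun a : V => (Pi.single a 1 : V → ℝ))
      (fun _ s => Set.image2 (midpoint ℝ) s s) k
  have hfin : ∀ k, (S k).Finite := by
    intro k
    induction k with
    | zero => exact Set.finite_range _
    | succ k ih => exact Set.Finite.image2 _ ih ih
  refine ⟨S k, hfin k, fun p q r h => ?_⟩
  induction h with
  | @base a b c h =>
    refine ⟨⟨a, ?_⟩, ⟨b, ?_⟩, ⟨c, ?_⟩⟩ <;> (ext; simp [Pi.single_apply])
  | rotate _ ih => exact ⟨ih.2.1, ih.2.2, ih.1⟩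
  | corner _ ih =>
    exact ⟨⟨_, ih.1, _, ih.1, midpoint_self ℝ _⟩, ⟨_, ih.1, _, ih.2.1, rfl⟩,
      ⟨_, ih.1, _, ih.2.2, rfl⟩⟩
  | center _ ih =>
    exact ⟨⟨_, ih.1, _, ih.2.1, rfl⟩, ⟨_, ih.2.1, _, ih.2.2, rfl⟩, ⟨_, ih.2.2, _, ih.1, rfl⟩⟩

instance [Finite V] (T : SurfaceTriangulation G) (k : ℕ) : Finite (T.HexVertex k) := by
  obtain ⟨S, hS, h⟩ := T.exists_finite_hexFace k
  exact (hS.subset fun p ⟨q, r, hp⟩ => (h p q r hp).1 :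
    {p : V → ℝ | ∃ q r, T.HexFace k p q r}.Finite).to_subtype

end SurfaceTriangulation

/-- `H` contains `G` as a `(ξ, ℓ)`-immersion: `H` is obtained from a copy of `G`, with vertices
`vertexMap v`, by replacing each edge of `G` with a path of length at most `ℓ` between its endpoints
(written once for each direction of the edge, `path_symm`), where each edge of `H` is used by at
most `ξ` of the paths, and `H` has no other edges or vertices. -/
structure GraphImmersion {V W : Type*} (G : SimpleGraph V) (H : SimpleGraph W) (ξ ℓ : ℕ) where
  vertexMap : V ↪ W
  path : ∀ d : G.Dart, H.Walk (vertexMap d.fst) (vertexMap d.snd)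
  isPath : ∀ d, (path d).IsPath
  path_symm : ∀ d, path d.symm = (path d).reverse
  length_le : ∀ d, (path d).length ≤ ℓ
  congestion_le : ∀ e ∈ H.edgeSet,
    {e' : Sym2 V | ∃ d : G.Dart, d.edge = e' ∧ e ∈ (path d).edges}.encard ≤ ξ
  edge_covered : ∀ e ∈ H.edgeSet, ∃ d, e ∈ (path d).edges
  vertex_covered : ∀ w : W, w ∈ Set.range vertexMap ∨ ∃ d, w ∈ (path d).support

/-- The Laplacian `(Δ f)(x) = ∑_{y ∼ x} (f x - f y)` of a finite graph; at a boundary vertex, the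
same sum is the outward normal derivative of `f`. -/
noncomputable def graphLaplacian {V : Type*} [Finite V] (G : SimpleGraph V) (f : V → ℝ) (x : V) :
    ℝ :=
  ∑ y ∈ (Set.toFinite (G.neighborSet x)).toFinset, (f x - f y)

/-- The solutions `f` of the Steklov problem on `(G, B)` for the number `t`: `f` is harmonic off the
boundary `B`, and its normal derivative on `B` is `t * f`. -/
def steklovEigenspace {V : Type*} [Finite V] (G : SimpleGraph V) (B : Set V) (t : ℝ) :
    Submodule ℝ (V → ℝ) where
  carrier := {f | (∀ x ∉ B, graphLaplacian G f x = 0) ∧ ∀ x ∈ B, graphLaplacian G f x = t * f x}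
  add_mem' := by
    rintro f g ⟨hf, hf'⟩ ⟨hg, hg'⟩
    have key : ∀ x, graphLaplacian G (f + g) x = graphLaplacian G f x + graphLaplacian G g x := by
      intro x
      simp only [graphLaplacian, Pi.add_apply, ← Finset.sum_add_distrib]
      exact Finset.sum_congr rfl fun y _ => by ring
    refine ⟨fun x hx => ?_, fun x hx => ?_⟩
    · rw [key, hf x hx, hg x hx, add_zero]
    · rw [key, hf' x hx, hg' x hx, Pi.add_apply, mul_add]
  zero_mem' := by simp [graphLaplacian]
  smul_mem' := by
    rintro a f ⟨hf, hf'⟩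
    have key : ∀ x, graphLaplacian G (a • f) x = a * graphLaplacian G f x := by
      intro x
      simp only [graphLaplacian, Pi.smul_apply, smul_eq_mul, Finset.mul_sum, mul_sub]
    refine ⟨fun x hx => ?_, fun x hx => ?_⟩
    · rw [key, hf x hx, mul_zero]
    · rw [key, hf' x hx, Pi.smul_apply, smul_eq_mul]
      ring

/-- The `j`-th smallest Steklov eigenvalue of `(G, B)`, counted with multiplicity from `j = 1`: the
least `t` such that the eigenfunctions with eigenvalue at most `t` span at least `j` dimensions.
It is meaningful for connected `G` and `1 ≤ j ≤ |B|`. -/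
noncomputable def steklovEigenvalue {V : Type*} [Finite V] (G : SimpleGraph V) (B : Set V)
    (j : ℕ) : ℝ :=
  sInf {t : ℝ | j ≤ Module.finrank ℝ (⨆ (s : ℝ) (_ : s ≤ t), steklovEigenspace G B s :
    Submodule ℝ (V → ℝ))}

/-!
The subgraph `H` is the union of the sides of the faces of `G`: in the `k`-fold subdivision each of
them is a path of length `n = 2 ^ k`, and different sides have no edge in common, so `G` is
immersed with congestion `1` (`exists_graphImmersion_sideGraph`). The boundary of the subdivision is
a union of patches: for every boundary vertex `v`, one face at `v` is chosen, and the patch of `v`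
consists of about `(n / 4) ^ 2` lattice points of this face near `v` (`patchUnion`). Different
patches are disjoint and have the same size.

The eigenvalues are compared by a test function. By the variational characterization of the second
Steklov eigenvalue (`steklovEigenvalue_two_spec`), there is a function `f` on the subdivision with
mean zero on the patches, `∑ f ^ 2 = 1` over the patches, and Dirichlet energy `λ₂`. Let `h v` be
the mean of `f` over the patch of `v`; it sums to zero over the boundary of `G`. Two estimates, both
invariant under scaling in the two-dimensional sense, relate `h` to `f`.

* The energy of `h` on `G` is at most a constant times the energy of `f`
  (`dirichletForm_vertexMean_le`). Patches at the two ends of a side of a triangle are exchanged by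
  a reflection that moves points along lattice lines parallel to the side, and patches in adjacent
  triangles at a common vertex are exchanged by reflecting in the common side, again along lattice
  lines. In both cases each line has length at most `n` and carries about `n / 4` points of a patch
  at most, and the Cauchy–Schwarz inequality along the lines bounds the difference of the means
  (`sq_patchMean_sub_le_of_side`, `sq_patchMean_sub_le_of_reflect`). Any two faces at a vertex are
  joined by at most `D` steps around it.
* The variance of `f` on the patches is at most `C * n ^ 2` times the energy of `f`, by the Poincaré
  inequality in a rhombus of lattice points (`sum_sq_sub_vertexMean_le`).

Interpolating `h` linearly along the sides gives a function on `H` with energy `1 / n` times that of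
`h` (`dirichletForm_interpolate_le`). If `λ₂` is small compared with `n⁻²`, the variance takes up at
most half of `∑ f ^ 2`, so `∑ h ^ 2` is at least of order `n⁻²`, and the Rayleigh quotient of the
interpolation is at most `C * n * λ₂`. If `λ₂` is at least of order `n⁻²`, it is enough that the
second eigenvalue of `H` is always at most of order `n⁻¹`, by a test function supported near two
boundary vertices (`steklovEigenvalue_sideGraph_le`).
-/

/-! ### The Dirichlet form and the second Steklov eigenvalue -/

/-- A function that varies by at most `s` along every edge varies by at most `s` times the number
of vertices on a connected component. -/
theorem SimpleGraph.Reachable.abs_sub_le {X : Type*} [Fintype X] {G : SimpleGraph X} {f : X → ℝ}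
    {s : ℝ} (hs0 : 0 ≤ s) (hs : ∀ x y, G.Adj x y → |f x - f y| ≤ s) {x y : X}
    (h : G.Reachable x y) : |f x - f y| ≤ Fintype.card X * s := by
  have key : ∀ {x y : X} (p : G.Walk x y), |f x - f y| ≤ p.length * s := by
    intro x y p
    induction p with
    | nil => simp
    | @cons u v w huv p ih =>
      have h1 := hs _ _ huv
      have h2 := _root_.abs_sub_le (f u) (f v) (f w)
      rw [SimpleGraph.Walk.length_cons]
      push_cast
      linarith
  obtain ⟨p, hp⟩ := h.exists_isPath
  have h1 := hp.length_lt
  have h2 : (p.length : ℝ) ≤ Fintype.card X := by exact_mod_cast h1.le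
  exact (key p).trans (mul_le_mul_of_nonneg_right h2 hs0)

open Classical in
/-- The Dirichlet form of a finite graph, summed over ordered pairs of adjacent vertices, so that
`dirichletForm G f f` is twice the Dirichlet energy of `f`. -/
noncomputable def dirichletForm {V : Type*} [Fintype V] (G : SimpleGraph V) (f g : V → ℝ) : ℝ :=
  ∑ x, ∑ y, if G.Adj x y then (f x - f y) * (g x - g y) else 0

section Steklov

variable {V : Type*} [Fintype V] {G : SimpleGraph V}

open Classical in
theorem graphLaplacian_eq_sum (G : SimpleGraph V) (f : V → ℝ) (x : V) :
    graphLaplacian G f x = ∑ y, if G.Adj x y then f x - f y else 0 := by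
  rw [graphLaplacian, ← Finset.sum_filter]
  exact Finset.sum_congr (by ext; simp) fun _ _ => rfl

/-- Green's formula. -/
theorem dirichletForm_eq_sum_mul_graphLaplacian (G : SimpleGraph V) (f g : V → ℝ) :
    dirichletForm G f g = 2 * ∑ x, g x * graphLaplacian G f x := by
  classical
  have h1 : ∑ x, g x * graphLaplacian G f x
      = ∑ x, ∑ y, if G.Adj x y then g x * (f x - f y) else 0 := by
    simp only [graphLaplacian_eq_sum, Finset.mul_sum, mul_ite, mul_zero]
  have h2 : ∑ x, g x * graphLaplacian G f x
      = ∑ x, ∑ y, if G.Adj x y then g y * (f y - f x) else 0 := by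
    rw [h1, Finset.sum_comm]
    simp only [G.adj_comm]
  rw [two_mul]
  nth_rewrite 1 [h1]
  rw [h2, dirichletForm, ← Finset.sum_add_distrib]
  refine Finset.sum_congr rfl fun x _ => ?_
  rw [← Finset.sum_add_distrib]
  refine Finset.sum_congr rfl fun y _ => ?_
  split_ifs <;> ring

theorem dirichletForm_self_nonneg (G : SimpleGraph V) (f : V → ℝ) : 0 ≤ dirichletForm G f f := by
  classical
  refine Finset.sum_nonneg fun x _ => Finset.sum_nonneg fun y _ => ?_
  split_ifs
  · exact mul_self_nonneg _
  · exact le_rfl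

theorem sq_sub_le_dirichletForm {f : V → ℝ} {x y : V} (h : G.Adj x y) :
    (f x - f y) ^ 2 ≤ dirichletForm G f f := by
  classical
  have hnn : ∀ x y, 0 ≤ if G.Adj x y then (f x - f y) * (f x - f y) else 0 := fun x y => by
    split_ifs
    · exact mul_self_nonneg _
    · exact le_rfl
  calc (f x - f y) ^ 2 = if G.Adj x y then (f x - f y) * (f x - f y) else 0 := by
        rw [if_pos h, sq]
    _ ≤ ∑ y, if G.Adj x y then (f x - f y) * (f x - f y) else 0 :=
        Finset.single_le_sum (f := fun y => if G.Adj x y then (f x - f y) * (f x - f y) else 0)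
          (fun y _ => hnn x y) (Finset.mem_univ y)
    _ ≤ _ := Finset.single_le_sum
        (f := fun x => ∑ y, if G.Adj x y then (f x - f y) * (f x - f y) else 0)
          (fun x _ => Finset.sum_nonneg fun y _ => hnn x y) (Finset.mem_univ x)

theorem abs_sub_le_of_dirichletForm_le (hG : G.Connected) {f : V → ℝ} {M : ℝ}
    (hf : dirichletForm G f f ≤ M) (x y : V) : |f x - f y| ≤ Fintype.card V * √M :=
  (hG.preconnected x y).abs_sub_le (Real.sqrt_nonneg _) fun _ _ h =>
    Real.abs_le_sqrt ((sq_sub_le_dirichletForm h).trans hf)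

theorem eq_of_dirichletForm_nonpos (hG : G.Connected) {f : V → ℝ}
    (hf : dirichletForm G f f ≤ 0) (x y : V) : f x = f y := by
  have := abs_sub_le_of_dirichletForm_le hG hf x y
  rw [Real.sqrt_zero, mul_zero] at this
  exact sub_eq_zero.1 (abs_nonpos_iff.1 this)

theorem dirichletForm_comm (f g : V → ℝ) : dirichletForm G f g = dirichletForm G g f := by
  simp only [dirichletForm, mul_comm]

theorem dirichletForm_add_left (f f' g : V → ℝ) :
    dirichletForm G (f + f') g = dirichletForm G f g + dirichletForm G f' g := by
  simp only [dirichletForm, ← Finset.sum_add_distrib]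
  refine Finset.sum_congr rfl fun x _ => Finset.sum_congr rfl fun y _ => ?_
  split_ifs
  · simp only [Pi.add_apply]; ring
  · simp

theorem dirichletForm_smul_left (a : ℝ) (f g : V → ℝ) :
    dirichletForm G (a • f) g = a * dirichletForm G f g := by
  simp only [dirichletForm, Finset.mul_sum]
  refine Finset.sum_congr rfl fun x _ => Finset.sum_congr rfl fun y _ => ?_
  split_ifs
  · simp only [Pi.smul_apply, smul_eq_mul]; ring
  · simp

theorem continuous_dirichletForm (G : SimpleGraph V) :
    Continuous fun f : V → ℝ => dirichletForm G f f := by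
  unfold dirichletForm
  refine continuous_finsetSum _ fun x _ => continuous_finsetSum _ fun y _ => ?_
  split_ifs <;> fun_prop

/-- If `a * ε + b * ε ^ 2` is nonnegative for all `ε`, then `a = 0`. -/
theorem eq_zero_of_forall_mul_add_mul_sq_nonneg {a b : ℝ} (h : ∀ ε : ℝ, 0 ≤ a * ε + b * ε ^ 2) :
    a = 0 := by
  have h1 := discrim_le_zero (a := b) (b := a) (c := 0) fun x => by nlinarith [h x]
  rw [discrim] at h1
  nlinarith [sq_nonneg a]

/-- The Rayleigh quotient over functions of zero mean on the boundary attains its infimum, by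
compactness of a sublevel set of the Dirichlet energy. -/
theorem exists_rayleigh_minimizer (hG : G.Connected) {s : Finset V} (hs : 1 < s.card) :
    ∃ (f : V → ℝ) (r : ℝ), ∑ x ∈ s, f x = 0 ∧ ∑ x ∈ s, f x ^ 2 = 1 ∧ dirichletForm G f f = r ∧
      ∀ g : V → ℝ, ∑ x ∈ s, g x = 0 → r * ∑ x ∈ s, g x ^ 2 ≤ dirichletForm G g g := by
  classical
  have hnormalize : ∀ g : V → ℝ, ∑ x ∈ s, g x = 0 → ∑ x ∈ s, g x ^ 2 ≠ 0 →
      ∃ a : ℝ, 0 < a ∧ a ^ 2 * ∑ x ∈ s, g x ^ 2 = 1 ∧ ∑ x ∈ s, (a • g) x = 0 ∧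
        ∑ x ∈ s, (a • g) x ^ 2 = 1 ∧ dirichletForm G (a • g) (a • g)
          = a ^ 2 * dirichletForm G g g := by
    intro g hg hg0
    have hpos : 0 < ∑ x ∈ s, g x ^ 2 :=
      lt_of_le_of_ne (Finset.sum_nonneg fun x _ => sq_nonneg _) (Ne.symm hg0)
    have ha : (√(∑ x ∈ s, g x ^ 2))⁻¹ ^ 2 * ∑ x ∈ s, g x ^ 2 = 1 := by
      rw [inv_pow, Real.sq_sqrt hpos.le]
      exact inv_mul_cancel₀ hg0
    refine ⟨(√(∑ x ∈ s, g x ^ 2))⁻¹, inv_pos.2 (Real.sqrt_pos.2 hpos), ha, ?_, ?_, ?_⟩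
    · simp only [Pi.smul_apply, smul_eq_mul, ← Finset.mul_sum, hg, mul_zero]
    · simp only [Pi.smul_apply, smul_eq_mul, mul_pow, ← Finset.mul_sum, ha]
    · rw [dirichletForm_smul_left, dirichletForm_comm, dirichletForm_smul_left]
      ring
  obtain ⟨u, hu, v, hv, huv⟩ := Finset.one_lt_card.1 hs
  have hg0 : ∑ x ∈ s, (Pi.single u 1 - Pi.single v 1 : V → ℝ) x = 0 := by
    simp [Finset.sum_sub_distrib, Finset.sum_pi_single', hu, hv]
  have hg1 : ∑ x ∈ s, (Pi.single u 1 - Pi.single v 1 : V → ℝ) x ^ 2 ≠ 0 := by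
    intro h
    have := (Finset.sum_eq_zero_iff_of_nonneg fun x _ => sq_nonneg _).1 h u hu
    simp [huv] at this
  obtain ⟨a, -, -, hf0, hf1, -⟩ := hnormalize _ hg0 hg1
  set f₀ : V → ℝ := a • (Pi.single u 1 - Pi.single v 1)
  set M := dirichletForm G f₀ f₀
  let K : Set (V → ℝ) :=
    {f | ∑ x ∈ s, f x = 0 ∧ ∑ x ∈ s, f x ^ 2 = 1 ∧ dirichletForm G f f ≤ M}
  have hclosed : IsClosed K := by
    refine (isClosed_eq ?_ continuous_const).inter
      ((isClosed_eq ?_ continuous_const).inter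
        (isClosed_le (continuous_dirichletForm G) continuous_const))
    · fun_prop
    · fun_prop
  have hbdd : K ⊆ Metric.closedBall 0 (1 + Fintype.card V * √M) := by
    rintro f ⟨-, hf1, hfM⟩
    rw [mem_closedBall_zero_iff, pi_norm_le_iff_of_nonneg (by positivity)]
    intro x
    have h1 : f u ^ 2 ≤ 1 := hf1 ▸ Finset.single_le_sum (f := fun x => f x ^ 2)
      (fun x _ => sq_nonneg _) hu
    have h2 : |f u| ≤ 1 := by rwa [← sq_le_one_iff_abs_le_one]
    have h3 := abs_sub_le_of_dirichletForm_le hG hfM x u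
    have h4 := abs_sub_abs_le_abs_sub (f x) (f u)
    rw [Real.norm_eq_abs]
    linarith
  have hK : IsCompact K := (isCompact_closedBall _ _).of_isClosed_subset hclosed hbdd
  obtain ⟨f, hfK, hmin⟩ := hK.exists_isMinOn ⟨f₀, hf0, hf1, le_rfl⟩
    (continuous_dirichletForm G).continuousOn
  refine ⟨f, _, hfK.1, hfK.2.1, rfl, fun g hg => ?_⟩
  by_cases hgz : ∑ x ∈ s, g x ^ 2 = 0
  · rw [hgz, mul_zero]
    exact dirichletForm_self_nonneg G g
  obtain ⟨a, ha, ha1, hg0, hg1, hE⟩ := hnormalize g hg hgz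
  have h1 : dirichletForm G f f ≤ a ^ 2 * dirichletForm G g g := by
    rw [← hE]
    by_cases hM : dirichletForm G (a • g) (a • g) ≤ M
    · exact hmin ⟨hg0, hg1, hM⟩
    · exact hfK.2.2.trans (not_le.1 hM).le
  have ha2 : 0 < a ^ 2 := by positivity
  refine le_of_mul_le_mul_left ?_ ha2
  calc a ^ 2 * (dirichletForm G f f * ∑ x ∈ s, g x ^ 2)
      = (a ^ 2 * ∑ x ∈ s, g x ^ 2) * dirichletForm G f f := by ring
    _ ≤ _ := by rw [ha1, one_mul]; exact h1

/-- The variational characterization of `λ₂`: it is the minimum of the Rayleigh quotient over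
functions of zero mean on the boundary (the factor `2` comes from the normalization of
`dirichletForm`). -/
theorem steklovEigenvalue_two_spec (hG : G.Connected) (B : Set V) {s : Finset V}
    (hsB : ∀ x, x ∈ s ↔ x ∈ B) (hs : 1 < s.card) :
    ∃ f : V → ℝ, ∑ x ∈ s, f x = 0 ∧ ∑ x ∈ s, f x ^ 2 = 1 ∧
      dirichletForm G f f = 2 * steklovEigenvalue G B 2 ∧
      ∀ g : V → ℝ, ∑ x ∈ s, g x = 0 →
        2 * steklovEigenvalue G B 2 * ∑ x ∈ s, g x ^ 2 ≤ dirichletForm G g g := by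
  classical
  obtain ⟨f, r, hf0, hf1, hfr, hmin⟩ := exists_rayleigh_minimizer hG hs
  have hs0 : (s.card : ℝ) ≠ 0 := by positivity
  have hsne : s.Nonempty := Finset.card_pos.1 (by omega)
  have hr0 : 0 ≤ r := hfr ▸ dirichletForm_self_nonneg G f
  -- the first variation vanishes in every direction of zero mean on the boundary
  have hvar0 : ∀ g : V → ℝ, ∑ x ∈ s, g x = 0 →
      dirichletForm G f g = r * ∑ x ∈ s, f x * g x := by
    intro g hg
    have := eq_zero_of_forall_mul_add_mul_sq_nonneg
      (a := 2 * (dirichletForm G f g - r * ∑ x ∈ s, f x * g x))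
      (b := dirichletForm G g g - r * ∑ x ∈ s, g x ^ 2) fun ε => by
        have h1 := hmin (f + ε • g) (by
          simp only [Pi.add_apply, Pi.smul_apply, smul_eq_mul, Finset.sum_add_distrib,
            ← Finset.mul_sum, hf0, hg, mul_zero, add_zero])
        have h2 : dirichletForm G (f + ε • g) (f + ε • g) = dirichletForm G f f
            + 2 * ε * dirichletForm G f g + ε ^ 2 * dirichletForm G g g := by
          rw [dirichletForm_add_left, dirichletForm_smul_left, dirichletForm_comm f,
            dirichletForm_comm g, dirichletForm_add_left, dirichletForm_add_left,
            dirichletForm_smul_left, dirichletForm_smul_left, dirichletForm_comm g f]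
          ring
        have h3 : ∑ x ∈ s, (f + ε • g) x ^ 2 = ∑ x ∈ s, f x ^ 2
            + 2 * ε * ∑ x ∈ s, f x * g x + ε ^ 2 * ∑ x ∈ s, g x ^ 2 := by
          simp only [Finset.mul_sum, ← Finset.sum_add_distrib]
          refine Finset.sum_congr rfl fun x _ => ?_
          simp only [Pi.add_apply, Pi.smul_apply, smul_eq_mul]
          ring
        rw [h2, h3, hf1, hfr] at h1
        linarith
    linarith
  have hvar : ∀ g : V → ℝ, dirichletForm G f g = r * ∑ x ∈ s, f x * g x := by
    intro g
    set a := (∑ x ∈ s, g x) / s.card with ha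
    have h1 := hvar0 (fun x => g x - a) (by
      rw [Finset.sum_sub_distrib, Finset.sum_const, nsmul_eq_mul, ha]
      field_simp
      ring)
    have h2 : dirichletForm G f (fun x => g x - a) = dirichletForm G f g := by
      simp only [dirichletForm, sub_sub_sub_cancel_right]
    have h3 : ∑ x ∈ s, f x * (g x - a) = ∑ x ∈ s, f x * g x := by
      simp only [mul_sub, Finset.sum_sub_distrib, ← Finset.sum_mul, hf0, zero_mul, sub_zero]
    rw [← h2, h1, h3]
  have hlap : ∀ x, graphLaplacian G f x = if x ∈ B then r / 2 * f x else 0 := by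
    intro x
    have h1 := hvar (Pi.single x 1)
    rw [dirichletForm_eq_sum_mul_graphLaplacian] at h1
    simp only [Pi.single_apply, ite_mul, one_mul, zero_mul, mul_ite, mul_one, mul_zero,
      Finset.sum_ite_eq', Finset.mem_univ, if_true, hsB] at h1
    split_ifs at h1 ⊢ <;> linarith
  have hfmem : f ∈ steklovEigenspace G B (r / 2) :=
    ⟨fun x hx => by rw [hlap, if_neg hx], fun x hx => by rw [hlap, if_pos hx]⟩
  have honemem : (1 : V → ℝ) ∈ steklovEigenspace G B 0 :=
    ⟨fun x _ => by simp [graphLaplacian], fun x _ => by simp [graphLaplacian]⟩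
  -- eigenfunctions for eigenvalues below the minimum are constant
  have hconst : ∀ t < r / 2, steklovEigenspace G B t ≤ Submodule.span ℝ {(1 : V → ℝ)} := by
    rintro t ht g ⟨hg1, hg2⟩
    have hgl : ∀ x, graphLaplacian G g x = if x ∈ s then t * g x else 0 := fun x => by
      split_ifs with h
      · exact hg2 x ((hsB x).1 h)
      · exact hg1 x (fun h' => h ((hsB x).2 h'))
    have hE : dirichletForm G g g = 2 * t * ∑ x ∈ s, g x ^ 2 := by
      rw [dirichletForm_eq_sum_mul_graphLaplacian]
      simp only [hgl, mul_ite, mul_zero, Finset.sum_ite_mem, Finset.univ_inter]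
      rw [Finset.mul_sum, Finset.mul_sum]
      exact Finset.sum_congr rfl fun x _ => by ring
    have hEle : dirichletForm G g g ≤ 0 := by
      by_cases ht0 : t = 0
      · rw [hE, ht0]; simp
      have hsum : t * ∑ x ∈ s, g x = 0 := by
        have h1 := dirichletForm_eq_sum_mul_graphLaplacian G g (1 : V → ℝ)
        have h2 : dirichletForm G g (1 : V → ℝ) = 0 := by simp [dirichletForm]
        simp only [hgl, h2, Pi.one_apply, one_mul, Finset.sum_ite_mem, Finset.univ_inter] at h1
        rw [Finset.mul_sum]
        linarith
      have h1 := hmin g ((mul_eq_zero.1 hsum).resolve_left ht0)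
      have h2 : 0 ≤ ∑ x ∈ s, g x ^ 2 := Finset.sum_nonneg fun x _ => sq_nonneg _
      have h3 : ∑ x ∈ s, g x ^ 2 = 0 := by nlinarith
      rw [hE, h3, mul_zero]
    obtain ⟨x₀, -⟩ := hsne
    refine Submodule.mem_span_singleton.2 ⟨g x₀, ?_⟩
    ext x
    simp [eq_of_dirichletForm_nonpos hG hEle x x₀]
  have hlow : ∀ t : ℝ, 2 ≤ Module.finrank ℝ (⨆ (s : ℝ) (_ : s ≤ t), steklovEigenspace G B s :
      Submodule ℝ (V → ℝ)) → r / 2 ≤ t := by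
    intro t ht
    by_contra! hlt
    have h1 : (⨆ (s : ℝ) (_ : s ≤ t), steklovEigenspace G B s : Submodule ℝ (V → ℝ))
        ≤ Submodule.span ℝ {(1 : V → ℝ)} :=
      iSup₂_le fun s hs => hconst s (hs.trans_lt hlt)
    have h2 := Submodule.finrank_mono h1
    have h3 := finrank_span_le_card (R := ℝ) ({(1 : V → ℝ)} : Set (V → ℝ))
    simp at h3
    omega
  have hmem : 2 ≤ Module.finrank ℝ (⨆ (s : ℝ) (_ : s ≤ r / 2), steklovEigenspace G B s :
      Submodule ℝ (V → ℝ)) := by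
    have hli : LinearIndependent ℝ ![(1 : V → ℝ), f] := by
      rw [LinearIndependent.pair_iff]
      intro a b hab
      have h1 : ∀ x, a + b * f x = 0 := fun x => by simpa using congrFun hab x
      have ha : a = 0 := by
        have h2 : ∑ x ∈ s, (a + b * f x) = 0 := Finset.sum_eq_zero fun x _ => h1 x
        rw [Finset.sum_add_distrib, ← Finset.mul_sum, hf0, Finset.sum_const, nsmul_eq_mul] at h2
        simpa [hs0] using h2
      refine ⟨ha, ?_⟩
      by_contra hb
      have h3 : ∑ x ∈ s, f x ^ 2 = 0 := Finset.sum_eq_zero fun x _ => by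
        have h4 := h1 x
        rw [ha, zero_add] at h4
        rw [(mul_eq_zero.1 h4).resolve_left hb]
        simp
      linarith
    have hle : Submodule.span ℝ (Set.range ![(1 : V → ℝ), f])
        ≤ ⨆ (s : ℝ) (_ : s ≤ r / 2), steklovEigenspace G B s := by
      rw [Submodule.span_le]
      rintro _ ⟨i, rfl⟩
      fin_cases i
      · exact (le_iSup₂_of_le (f := fun (s : ℝ) (_ : s ≤ r / 2) => steklovEigenspace G B s) 0
          (by linarith) le_rfl) honemem
      · exact (le_iSup₂_of_le (f := fun (s : ℝ) (_ : s ≤ r / 2) => steklovEigenspace G B s)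
          (r / 2) le_rfl le_rfl) hfmem
    have h1 := Submodule.finrank_mono hle
    rw [finrank_span_eq_card hli] at h1
    simpa using h1
  have hval : steklovEigenvalue G B 2 = r / 2 :=
    le_antisymm (csInf_le ⟨r / 2, hlow⟩ hmem) (le_csInf ⟨_, hmem⟩ hlow)
  have h2 : 2 * steklovEigenvalue G B 2 = r := by rw [hval]; ring
  exact ⟨f, hf0, hf1, by rw [h2, hfr], fun g hg => by rw [h2]; exact hmin g hg⟩

end Steklov

/-! ### Lattice points of the hexagon subdivision -/

namespace SurfaceTriangulation

open Classical in
/-- The point `(x e_a + y e_b + z e_c) / 2 ^ k`. When `a b c` is a face and `x + y + z = 2 ^ k`,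
this is a vertex of the `k`-fold hexagon subdivision. -/
noncomputable def latticePoint {V : Type*} (k : ℕ) (a b c : V) (x y z : ℕ) : V → ℝ :=
  (2 ^ k : ℝ)⁻¹ • ((x : ℝ) • Pi.single a 1 + (y : ℝ) • Pi.single b 1 + (z : ℝ) • Pi.single c 1)

section

variable {V : Type*} {G : SimpleGraph V} (T : SurfaceTriangulation G) {k : ℕ} {a b c : V}

theorem latticePoint_rotate (k : ℕ) (a b c : V) (x y z : ℕ) :
    latticePoint k a b c x y z = latticePoint k b c a y z x := by
  simp only [latticePoint]; congr 1; abel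

theorem latticePoint_swap (k : ℕ) (a b c : V) (x y z : ℕ) :
    latticePoint k a b c x y z = latticePoint k b a c y x z := by
  simp only [latticePoint]; congr 1; abel

theorem midpoint_latticePoint {x y z x' y' z' x'' y'' z'' : ℕ} (hx : x + x' = x'')
    (hy : y + y' = y'') (hz : z + z' = z'') :
    midpoint ℝ (latticePoint k a b c x y z) (latticePoint k a b c x' y' z')
      = latticePoint (k + 1) a b c x'' y'' z'' := by
  subst hx hy hz
  rw [midpoint_eq_smul_add]
  simp only [latticePoint, invOf_eq_inv, pow_succ, mul_inv]
  push_cast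
  module

theorem latticePoint_eq_succ {x y z x'' y'' z'' : ℕ} (hx : x + x = x'')
    (hy : y + y = y'') (hz : z + z = z'') :
    latticePoint k a b c x y z = latticePoint (k + 1) a b c x'' y'' z'' := by
  rw [← midpoint_latticePoint hx hy hz, midpoint_self]

variable {T} in
/-- Faces of the subdivision inside a face `a b c`: the translates of `a b c` scaled by `2 ^ (-k)`,
and those of its image under a half turn. In the induction, a corner triangle is parallel to the
triangle it is cut from, and a central triangle is turned by a half turn. -/
theorem hexFace_latticePoint (h : T.face a b c) (k : ℕ) :
    (∀ x y z : ℕ, x + y + z + 1 = 2 ^ k → T.HexFace k (latticePoint k a b c (x + 1) y z)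
      (latticePoint k a b c x (y + 1) z) (latticePoint k a b c x y (z + 1))) ∧
    (∀ x y z : ℕ, x + y + z + 2 = 2 ^ k → T.HexFace k (latticePoint k a b c (x + 1) (y + 1) z)
      (latticePoint k a b c x (y + 1) (z + 1)) (latticePoint k a b c (x + 1) y (z + 1))) := by
  induction k with
  | zero =>
    refine ⟨fun x y z hs => ?_, fun x y z hs => by simp at hs⟩
    obtain ⟨rfl, rfl, rfl⟩ : x = 0 ∧ y = 0 ∧ z = 0 := by
      rw [pow_zero] at hs; omega
    simpa [latticePoint] using HexFace.base h
  | succ k ih =>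
    obtain ⟨up, down⟩ := ih
    rw [pow_succ]
    constructor
    · intro x y z hs
      obtain ⟨x', hx⟩ := Nat.even_or_odd' x
      obtain ⟨y', hy⟩ := Nat.even_or_odd' y
      obtain ⟨z', hz⟩ := Nat.even_or_odd' z
      rcases hx with rfl | rfl <;> rcases hy with rfl | rfl <;> rcases hz with rfl | rfl
      any_goals omega
      · convert (up x' y' z' (by omega)).rotate.rotate.corner.rotate using 1 <;> symm <;>
          first
          | (apply latticePoint_eq_succ <;> omega)
          | (apply midpoint_latticePoint <;> omega)
      · convert (up x' y' z' (by omega)).rotate.corner.rotate.rotate using 1 <;> symm <;>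
          first
          | (apply latticePoint_eq_succ <;> omega)
          | (apply midpoint_latticePoint <;> omega)
      · convert (up x' y' z' (by omega)).corner using 1 <;> symm <;>
          first
          | (apply latticePoint_eq_succ <;> omega)
          | (apply midpoint_latticePoint <;> omega)
      · convert (down x' y' z' (by omega)).center.rotate.rotate using 1 <;> symm <;>
          apply midpoint_latticePoint <;> omega
    · intro x y z hs
      obtain ⟨x', hx⟩ := Nat.even_or_odd' x
      obtain ⟨y', hy⟩ := Nat.even_or_odd' y
      obtain ⟨z', hz⟩ := Nat.even_or_odd' z
      rcases hx with rfl | rfl <;> rcases hy with rfl | rfl <;> rcases hz with rfl | rfl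
      any_goals omega
      · convert (up x' y' z' (by omega)).center using 1 <;> symm <;>
          apply midpoint_latticePoint <;> omega
      · convert (down x' y' z' (by omega)).rotate.corner.rotate.rotate using 1 <;> symm <;>
          first
          | (apply latticePoint_eq_succ <;> omega)
          | (apply midpoint_latticePoint <;> omega)
      · convert (down x' y' z' (by omega)).rotate.rotate.corner.rotate using 1 <;> symm <;>
          first
          | (apply latticePoint_eq_succ <;> omega)
          | (apply midpoint_latticePoint <;> omega)
      · convert (down x' y' z' (by omega)).corner using 1 <;> symm <;>
          first
          | (apply latticePoint_eq_succ <;> omega)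
          | (apply midpoint_latticePoint <;> omega)

/-- `a`, `b`, `c` are the corners of a face, in either orientation. -/
def IsTriangle (a b c : V) : Prop := T.face a b c ∨ T.face b a c

variable {T}

theorem IsTriangle.swap (h : T.IsTriangle a b c) : T.IsTriangle b a c := Or.symm h

theorem IsTriangle.rotate (h : T.IsTriangle a b c) : T.IsTriangle b c a :=
  h.imp T.face_rotate fun h => T.face_rotate (T.face_rotate h)

theorem IsTriangle.adj (h : T.IsTriangle a b c) : G.Adj a b :=
  h.elim T.adj_of_face fun h => (T.adj_of_face h).symm

theorem IsTriangle.ne (h : T.IsTriangle a b c) : a ≠ b := h.adj.ne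

theorem exists_hexFace_latticePoint (h : T.IsTriangle a b c) {x y z : ℕ}
    (hs : x + y + z = 2 ^ k) : ∃ q r, T.HexFace k (latticePoint k a b c x y z) q r := by
  have key : ∀ {a b c : V} {x y z : ℕ}, T.face a b c → x + y + z = 2 ^ k →
      ∃ q r, T.HexFace k (latticePoint k a b c x y z) q r := by
    intro a b c x y z h hs
    have hup := (hexFace_latticePoint h k).1
    have hpos : 0 < 2 ^ k := by positivity
    rcases x with _ | x
    · rcases y with _ | y
      · rcases z with _ | z
        · omega
        · exact ⟨_, _, (hup 0 0 z (by omega)).rotate.rotate⟩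
      · exact ⟨_, _, (hup 0 y z (by omega)).rotate⟩
    · exact ⟨_, _, hup x y z (by omega)⟩
  rcases h with h | h
  · exact key h hs
  · rw [latticePoint_swap]
    exact key h (by omega)

theorem latticePoint_apply_left (hab : a ≠ b) (hac : a ≠ c) (x y z : ℕ) :
    latticePoint k a b c x y z a = x / 2 ^ k := by
  simp [latticePoint, hab, hac, div_eq_inv_mul]

theorem latticePoint_apply_of_ne {v : V} (ha : v ≠ a) (hb : v ≠ b) (hc : v ≠ c) (x y z : ℕ) :
    latticePoint k a b c x y z v = 0 := by
  simp [latticePoint, ha, hb, hc]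

variable (T) in
/-- The sum of the coordinates of a point of the subdivision is `1`, so no vertex is the origin. -/
theorem HexVertex.exists_apply_ne_zero (p : T.HexVertex k) : ∃ v, p.1 v ≠ 0 := by
  have key : ∀ {k : ℕ} {p q r : V → ℝ}, T.HexFace k p q r → ∃ S : Finset V,
      ∀ S' : Finset V, S ⊆ S' → ∑ v ∈ S', p v = 1 ∧ ∑ v ∈ S', q v = 1 ∧ ∑ v ∈ S', r v = 1 := by
    classical
    intro k p q r h
    have hm : ∀ (S : Finset V) (p q : V → ℝ), ∑ v ∈ S, p v = 1 → ∑ v ∈ S, q v = 1 →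
        ∑ v ∈ S, midpoint ℝ p q v = 1 := by
      intro S p q hp hq
      simp only [midpoint_eq_smul_add, Pi.smul_apply, Pi.add_apply, smul_eq_mul,
        ← Finset.mul_sum, Finset.sum_add_distrib, hp, hq, invOf_eq_inv]
      norm_num
    induction h with
    | @base a b c h =>
      refine ⟨{a, b, c}, fun S' hS => ?_⟩
      have ha : a ∈ S' := hS (by simp)
      have hb : b ∈ S' := hS (by simp)
      have hc : c ∈ S' := hS (by simp)
      refine ⟨?_, ?_, ?_⟩ <;> simp [Pi.single_apply, ha, hb, hc]
    | rotate _ ih =>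
      obtain ⟨S, hS⟩ := ih
      exact ⟨S, fun S' h => ⟨(hS S' h).2.1, (hS S' h).2.2, (hS S' h).1⟩⟩
    | corner _ ih =>
      obtain ⟨S, hS⟩ := ih
      refine ⟨S, fun S' h => ?_⟩
      obtain ⟨hp, hq, hr⟩ := hS S' h
      exact ⟨hp, hm _ _ _ hp hq, hm _ _ _ hp hr⟩
    | center _ ih =>
      obtain ⟨S, hS⟩ := ih
      refine ⟨S, fun S' h => ?_⟩
      obtain ⟨hp, hq, hr⟩ := hS S' h
      exact ⟨hm _ _ _ hp hq, hm _ _ _ hq hr, hm _ _ _ hr hp⟩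
  obtain ⟨p, q, r, h⟩ := p
  obtain ⟨S, hS⟩ := key h
  by_contra! h0
  have := (hS S subset_rfl).1
  rw [Finset.sum_eq_zero fun v _ => h0 v] at this
  exact zero_ne_one this

theorem exists_face (a : V) : ∃ b c, T.face a b c := by
  have := T.nontrivial
  obtain ⟨b, hb⟩ := T.connected.preconnected.exists_adj_of_nontrivial a
  obtain ⟨c, hc, -⟩ := T.existsUnique_face hb
  exact ⟨b, c, hc⟩

variable (T) in
theorem nonempty_hexVertex (k : ℕ) : Nonempty (T.HexVertex k) := by
  obtain ⟨a⟩ := T.connected.nonempty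
  obtain ⟨b, c, h⟩ := exists_face (T := T) a
  exact ⟨⟨_, exists_hexFace_latticePoint (Or.inl h) (x := 2 ^ k) (y := 0) (z := 0) rfl⟩⟩

open Classical in
variable (T) in
/-- The vertex of the subdivision at a given point (an arbitrary vertex if there is none). -/
noncomputable def hexVertexAt (k : ℕ) (p : V → ℝ) : T.HexVertex k :=
  if h : ∃ q r, T.HexFace k p q r then ⟨p, h⟩ else Classical.choice (T.nonempty_hexVertex k)

theorem hexVertexAt_val {p : V → ℝ} (h : ∃ q r, T.HexFace k p q r) :
    (T.hexVertexAt k p).1 = p :=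
  congrArg Subtype.val (dif_pos h)

variable (T) in
/-- The vertex `(x e_a + y e_b + z e_c) / 2 ^ k` of the subdivision. -/
noncomputable def lat (k : ℕ) (a b c : V) (x y z : ℕ) : T.HexVertex k :=
  T.hexVertexAt k (latticePoint k a b c x y z)

theorem lat_val (h : T.IsTriangle a b c) {x y z : ℕ} (hs : x + y + z = 2 ^ k) :
    (T.lat k a b c x y z).1 = latticePoint k a b c x y z :=
  hexVertexAt_val (exists_hexFace_latticePoint h hs)

theorem lat_rotate (a b c : V) (x y z : ℕ) : T.lat k a b c x y z = T.lat k b c a y z x := by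
  rw [lat, latticePoint_rotate, lat]

theorem lat_swap (a b c : V) (x y z : ℕ) : T.lat k a b c x y z = T.lat k b a c y x z := by
  rw [lat, latticePoint_swap, lat]

theorem lat_zero_right (a b c c' : V) (x y : ℕ) : T.lat k a b c x y 0 = T.lat k a b c' x y 0 := by
  simp [lat, latticePoint]

theorem lat_apply_left (h : T.IsTriangle a b c) {x y z : ℕ} (hs : x + y + z = 2 ^ k) :
    (T.lat k a b c x y z).1 a = x / 2 ^ k := by
  rw [lat_val h hs, latticePoint_apply_left h.ne h.rotate.rotate.ne.symm]

theorem lat_apply_mid (h : T.IsTriangle a b c) {x y z : ℕ} (hs : x + y + z = 2 ^ k) :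
    (T.lat k a b c x y z).1 b = y / 2 ^ k := by
  rw [lat_rotate, lat_apply_left h.rotate (by omega)]

theorem lat_apply_right (h : T.IsTriangle a b c) {x y z : ℕ} (hs : x + y + z = 2 ^ k) :
    (T.lat k a b c x y z).1 c = z / 2 ^ k := by
  rw [lat_rotate, lat_apply_mid h.rotate (by omega)]

theorem lat_apply_of_ne (h : T.IsTriangle a b c) {x y z : ℕ} (hs : x + y + z = 2 ^ k) {v : V}
    (ha : v ≠ a) (hb : v ≠ b) (hc : v ≠ c) : (T.lat k a b c x y z).1 v = 0 := by
  rw [lat_val h hs, latticePoint_apply_of_ne ha hb hc]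

theorem cast_div_two_pow_inj {x y : ℕ} (h : (x : ℝ) / 2 ^ k = y / 2 ^ k) : x = y := by
  have : (2 ^ k : ℝ) ≠ 0 := by positivity
  exact_mod_cast (div_left_inj' this).1 h

theorem lat_inj (h : T.IsTriangle a b c) {x y z x' y' z' : ℕ} (hs : x + y + z = 2 ^ k)
    (hs' : x' + y' + z' = 2 ^ k) (he : T.lat k a b c x y z = T.lat k a b c x' y' z') :
    x = x' ∧ y = y' ∧ z = z' := by
  refine ⟨?_, ?_, ?_⟩ <;> apply cast_div_two_pow_inj (k := k)
  · rw [← lat_apply_left h hs, he, lat_apply_left h hs']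
  · rw [← lat_apply_mid h hs, he, lat_apply_mid h hs']
  · rw [← lat_apply_right h hs, he, lat_apply_right h hs']

/-- Moving one step in the direction of the side `a b` of a triangle is moving along an edge. -/
theorem hexGraph_adj_lat (h : T.IsTriangle a b c) {x y z : ℕ} (hs : x + y + z + 1 = 2 ^ k) :
    (T.hexGraph k).Adj (T.lat k a b c (x + 1) y z) (T.lat k a b c x (y + 1) z) := by
  rw [hexGraph, SimpleGraph.fromRel_adj]
  refine ⟨fun he => ?_, ?_⟩
  · have := (lat_inj h (by omega) (by omega) he).1
    omega
  · rw [lat_val h (by omega), lat_val h (by omega)]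
    rcases h with h | h
    · exact Or.inl ⟨_, (hexFace_latticePoint h k).1 x y z hs⟩
    · have h2 := (hexFace_latticePoint h k).1 y x z (by omega)
      rw [latticePoint_swap k b a c (y + 1), latticePoint_swap k b a c y (x + 1)] at h2
      exact Or.inr ⟨_, h2⟩

/-! ### Connectedness of the subdivision -/

theorem HexFace.ne {k : ℕ} {p q r : V → ℝ} (h : T.HexFace k p q r) : p ≠ q ∧ q ≠ r ∧ r ≠ p := by
  classical
  have hm : ∀ x y z : V → ℝ, midpoint ℝ x y = midpoint ℝ x z → y = z := fun x y z h => by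
    have := (midpoint_eq_midpoint_iff_vsub_eq_vsub ℝ).1 h
    rw [vsub_self] at this
    exact (vsub_eq_zero_iff_eq.1 this.symm).symm
  induction h with
  | @base a b c h =>
    have h1 := T.face_rotate h
    have h2 := T.face_rotate h1
    have hne : ∀ {u v : V}, G.Adj u v → (Pi.single u 1 : V → ℝ) ≠ Pi.single v 1 := by
      intro u v huv he
      have := congrFun he u
      simp [huv.ne] at this
    exact ⟨hne (T.adj_of_face h), hne (T.adj_of_face h1), hne (T.adj_of_face h2)⟩
  | rotate _ ih => exact ⟨ih.2.1, ih.2.2, ih.1⟩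
  | corner _ ih =>
    refine ⟨fun h => ih.1 (by simpa using h.symm), fun h => ih.2.1 (hm _ _ _ h), fun h =>
      ih.2.2 (Eq.symm (by simpa using h))⟩
  | center _ ih =>
    refine ⟨fun h => ih.2.2 ?_, fun h => ih.1 ?_, fun h => ih.2.1 ?_⟩
    · rw [midpoint_comm] at h; exact (hm _ _ _ h).symm
    · rw [midpoint_comm] at h; exact (hm _ _ _ h).symm
    · rw [midpoint_comm] at h; exact (hm _ _ _ h).symm

theorem hexGraph_adj_of_hexFace {p q : T.HexVertex k} {r : V → ℝ} (h : T.HexFace k p.1 q.1 r) :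
    (T.hexGraph k).Adj p q := by
  rw [hexGraph, SimpleGraph.fromRel_adj]
  exact ⟨fun he => h.ne.1 (congrArg Subtype.val he), Or.inl ⟨r, h⟩⟩

/-- The vertices of the subdivision are among those of the next one. -/
def HexVertex.succ (p : T.HexVertex k) : T.HexVertex (k + 1) :=
  ⟨p.1, by obtain ⟨q, r, h⟩ := p.2; exact ⟨_, _, h.corner⟩⟩

theorem HexFace.exists_reachable_succ {l : ℕ} {p q r : V → ℝ} (h : T.HexFace l p q r) :
    ∀ {k : ℕ} (_ : l = k + 1) (v : T.HexVertex (k + 1)), v.1 = p ∨ v.1 = q ∨ v.1 = r →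
      ∃ u : T.HexVertex k, (T.hexGraph (k + 1)).Reachable u.succ v := by
  have key : ∀ {k : ℕ} {p q r : V → ℝ} {v : T.HexVertex (k + 1)}, T.HexFace k p q r →
      v.1 = midpoint ℝ p q → ∃ u : T.HexVertex k, (T.hexGraph (k + 1)).Reachable u.succ v := by
    intro k p q r v h hv
    refine ⟨⟨p, q, r, h⟩, SimpleGraph.Adj.reachable (hexGraph_adj_of_hexFace
      (r := midpoint ℝ p r) ?_)⟩
    rw [hv]
    exact h.corner
  induction h with
  | base => intro k hk; omega
  | rotate _ ih => exact fun hk v hv => ih hk v (by tauto)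
  | @corner _ p q r h _ =>
    intro k hk v hv
    obtain rfl := Nat.succ_injective hk
    rcases hv with hv | hv | hv
    · exact ⟨⟨v.1, q, r, hv ▸ h⟩, .refl _⟩
    · exact key h hv
    · exact key h.rotate.rotate (hv.trans (midpoint_comm _ _))
  | center h _ =>
    intro k hk v hv
    obtain rfl := Nat.succ_injective hk
    rcases hv with hv | hv | hv
    · exact key h hv
    · exact key h.rotate hv
    · exact key h.rotate.rotate hv

variable (T) in
theorem hexGraph_connected (k : ℕ) : (T.hexGraph k).Connected := by
  classical
  have := T.nonempty_hexVertex k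
  refine ⟨?_⟩
  induction k with
  | zero =>
    have hv : ∀ {a : V}, ∃ q r, T.HexFace 0 (Pi.single a 1) q r := by
      intro a
      obtain ⟨b, c, h⟩ := exists_face (T := T) a
      exact ⟨_, _, HexFace.base h⟩
    have hadj : ∀ {a b : V}, G.Adj a b →
        (T.hexGraph 0).Adj ⟨Pi.single a 1, hv⟩ ⟨Pi.single b 1, hv⟩ := by
      intro a b h
      obtain ⟨c, hc, -⟩ := T.existsUnique_face h
      exact hexGraph_adj_of_hexFace (HexFace.base hc)
    have hreach : ∀ a b : V,
        (T.hexGraph 0).Reachable ⟨Pi.single a 1, hv⟩ ⟨Pi.single b 1, hv⟩ := by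
      intro a b
      obtain ⟨w⟩ := T.connected.preconnected a b
      induction w with
      | nil => exact .refl _
      | cons h _ ih => exact (hadj h).reachable.trans ih
    have hsurj : ∀ p : T.HexVertex 0, ∃ a, p.1 = Pi.single a 1 := by
      have key : ∀ {k : ℕ} {p q r : V → ℝ}, T.HexFace k p q r → k = 0 →
          (∃ a, p = Pi.single a 1) ∧ (∃ a, q = Pi.single a 1) ∧ ∃ a, r = Pi.single a 1 := by
        intro k p q r h hk
        induction h with
        | @base a b c h => exact ⟨⟨a, rfl⟩, ⟨b, rfl⟩, ⟨c, rfl⟩⟩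
        | rotate _ ih => exact ⟨(ih hk).2.1, (ih hk).2.2, (ih hk).1⟩
        | corner => omega
        | center => omega
      rintro ⟨p, q, r, h⟩
      exact (key h rfl).1
    intro p q
    obtain ⟨a, ha⟩ := hsurj p
    obtain ⟨b, hb⟩ := hsurj q
    have h := hreach a b
    rwa [show (⟨Pi.single a 1, hv⟩ : T.HexVertex 0) = p from Subtype.ext ha.symm,
      show (⟨Pi.single b 1, hv⟩ : T.HexVertex 0) = q from Subtype.ext hb.symm] at h
  | succ k ih =>
    have := T.nonempty_hexVertex k
    have key : ∀ {p q : T.HexVertex k} {r : V → ℝ}, T.HexFace k p.1 q.1 r →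
        (T.hexGraph (k + 1)).Reachable p.succ q.succ := by
      intro p q r h
      let m : T.HexVertex (k + 1) := ⟨midpoint ℝ p.1 q.1, _, _, h.corner.rotate⟩
      have h1 : (T.hexGraph (k + 1)).Adj p.succ m := hexGraph_adj_of_hexFace h.corner
      have h2 : (T.hexGraph (k + 1)).Adj m q.succ := by
        refine hexGraph_adj_of_hexFace (r := midpoint ℝ q.1 r) ?_
        have := h.rotate.corner.rotate.rotate
        rwa [midpoint_comm q.1 p.1] at this
      exact h1.reachable.trans h2.reachable
    have hreach : ∀ p q : T.HexVertex k, (T.hexGraph (k + 1)).Reachable p.succ q.succ := by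
      intro p q
      obtain ⟨w⟩ := ih (T.nonempty_hexVertex k) p q
      induction w with
      | nil => exact .refl _
      | cons h _ ih =>
        rw [hexGraph, SimpleGraph.fromRel_adj] at h
        obtain ⟨-, ⟨r, hr⟩ | ⟨r, hr⟩⟩ := h
        · exact (key hr).trans ih
        · exact (key hr).symm.trans ih
    intro p q
    obtain ⟨p', hp⟩ : ∃ u : T.HexVertex k, (T.hexGraph (k + 1)).Reachable u.succ p := by
      obtain ⟨_, _, h⟩ := p.2
      exact h.exists_reachable_succ rfl p (Or.inl rfl)
    obtain ⟨q', hq⟩ : ∃ u : T.HexVertex k, (T.hexGraph (k + 1)).Reachable u.succ q := by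
      obtain ⟨_, _, h⟩ := q.2
      exact h.exists_reachable_succ rfl q (Or.inl rfl)
    exact hp.symm.trans ((hreach p' q').trans hq)

end

end SurfaceTriangulation

/-! ### The subdivided copy of `G` -/

open Classical in
theorem dirichletForm_self_eq_sum {V : Type*} [Fintype V] (G : SimpleGraph V) (f : V → ℝ) :
    dirichletForm G f f = ∑ p : V × V with G.Adj p.1 p.2, (f p.1 - f p.2) ^ 2 := by
  rw [Finset.sum_filter, Fintype.sum_prod_type]
  simp only [dirichletForm, sq]

/-- A sequence of consecutively adjacent vertices is a walk. -/
theorem SimpleGraph.exists_walk_of_forall_adj {W : Type*} {H : SimpleGraph W} (p : ℕ → W) (n : ℕ)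
    (h : ∀ i < n, H.Adj (p i) (p (i + 1))) {u v : W} (hu : p 0 = u) (hv : p n = v) :
    ∃ w : H.Walk u v, w.support = (List.range (n + 1)).map p ∧
      w.edges = (List.range n).map fun i => s(p i, p (i + 1)) := by
  subst hu hv
  induction n with
  | zero => exact ⟨.nil, by simp⟩
  | succ n ih =>
    obtain ⟨w, h1, h2⟩ := ih fun i hi => h i (by omega)
    refine ⟨w.concat (h n (by omega)), ?_, ?_⟩
    · rw [SimpleGraph.Walk.support_concat, h1, List.range_succ (n := n + 1)]
      simp
    · rw [SimpleGraph.Walk.edges_concat, h2, List.range_succ (n := n)]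
      simp

namespace SurfaceTriangulation

section

variable {V : Type*} {G : SimpleGraph V} (T : SurfaceTriangulation G) (k : ℕ)

open Classical in
/-- The vertex of the subdivision at a vertex `a` of `G`. -/
noncomputable def hexCorner (a : V) : T.HexVertex k := T.hexVertexAt k (Pi.single a 1)

/-- The `s`-th of the `2 ^ k + 1` vertices of the subdivision on the edge of `G` from `a` to `b`. -/
noncomputable def edgePoint (a b : V) (s : ℕ) : T.HexVertex k := T.lat k a b b (2 ^ k - s) s 0

variable {T k} {a b : V}

theorem exists_isTriangle (h : G.Adj a b) : ∃ c, T.IsTriangle a b c :=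
  (T.existsUnique_face h).exists.imp fun _ hc => Or.inl hc

theorem edgePoint_symm {s : ℕ} (hs : s ≤ 2 ^ k) :
    T.edgePoint k b a (2 ^ k - s) = T.edgePoint k a b s := by
  rw [edgePoint, edgePoint, lat_swap, Nat.sub_sub_self hs]
  exact lat_zero_right _ _ _ _ _ _

theorem edgePoint_zero : T.edgePoint k a b 0 = T.hexCorner k a := by
  simp [edgePoint, lat, hexCorner, latticePoint]

theorem edgePoint_two_pow : T.edgePoint k a b (2 ^ k) = T.hexCorner k b := by
  rw [← edgePoint_symm le_rfl, Nat.sub_self, edgePoint_zero]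

theorem edgePoint_apply_left (h : G.Adj a b) {s : ℕ} (hs : s ≤ 2 ^ k) :
    (T.edgePoint k a b s).1 a = ((2 ^ k - s : ℕ) : ℝ) / 2 ^ k := by
  obtain ⟨c, hc⟩ := exists_isTriangle (T := T) h
  rw [edgePoint, lat_zero_right _ _ _ c, lat_apply_left hc (by omega)]

theorem edgePoint_apply_right (h : G.Adj a b) {s : ℕ} (hs : s ≤ 2 ^ k) :
    (T.edgePoint k a b s).1 b = (s : ℝ) / 2 ^ k := by
  obtain ⟨c, hc⟩ := exists_isTriangle (T := T) h
  rw [edgePoint, lat_zero_right _ _ _ c, lat_apply_mid hc (by omega)]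

theorem edgePoint_apply_of_ne (h : G.Adj a b) {s : ℕ} (hs : s ≤ 2 ^ k) {v : V} (ha : v ≠ a)
    (hb : v ≠ b) : (T.edgePoint k a b s).1 v = 0 := by
  obtain ⟨c, hc⟩ := exists_isTriangle (T := T) h
  rw [edgePoint, lat_zero_right _ _ _ c]
  rcases eq_or_ne v c with rfl | hvc
  · rw [lat_apply_right hc (by omega)]; simp
  · exact lat_apply_of_ne hc (by omega) ha hb hvc

theorem edgePoint_injOn (h : G.Adj a b) {s s' : ℕ} (hs : s ≤ 2 ^ k) (hs' : s' ≤ 2 ^ k)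
    (he : T.edgePoint k a b s = T.edgePoint k a b s') : s = s' := by
  apply cast_div_two_pow_inj (k := k)
  rw [← edgePoint_apply_right (T := T) h hs, he, edgePoint_apply_right h hs']

theorem hexCorner_apply_self (a : V) : (T.hexCorner k a).1 a = 1 := by
  obtain ⟨b, c, h⟩ := exists_face (T := T) a
  rw [← edgePoint_zero (b := b), edgePoint_apply_left (T.adj_of_face h) (Nat.zero_le _)]
  simp

theorem hexCorner_apply_of_ne {v : V} (h : v ≠ a) : (T.hexCorner k a).1 v = 0 := by
  obtain ⟨b, c, hf⟩ := exists_face (T := T) a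
  have hab := T.adj_of_face hf
  rw [← edgePoint_zero (b := b)]
  rcases eq_or_ne v b with rfl | hb
  · rw [edgePoint_apply_right hab (Nat.zero_le _)]; simp
  · exact edgePoint_apply_of_ne hab (Nat.zero_le _) h hb

theorem hexCorner_injective : Function.Injective (T.hexCorner k) := by
  intro a b h
  by_contra hab
  have h1 := hexCorner_apply_self (T := T) (k := k) a
  rw [h, hexCorner_apply_of_ne hab] at h1
  exact zero_ne_one h1

theorem hexGraph_adj_edgePoint (h : G.Adj a b) {s : ℕ} (hs : s < 2 ^ k) :
    (T.hexGraph k).Adj (T.edgePoint k a b s) (T.edgePoint k a b (s + 1)) := by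
  obtain ⟨c, hc⟩ := exists_isTriangle (T := T) h
  rw [edgePoint, edgePoint, lat_zero_right _ _ _ c, lat_zero_right _ _ b c,
    show 2 ^ k - s = 2 ^ k - (s + 1) + 1 by omega]
  exact hexGraph_adj_lat hc (by omega)

/-- For an edge of the subdivision on the side `a b`, the coordinates of the sum of its two ends
that do not vanish are those at `a` and `b`. Hence the edge determines the side. -/
theorem edgePoint_add_apply_ne_zero_iff (h : G.Adj a b) {s : ℕ} (hs : s < 2 ^ k) (v : V) :
    (T.edgePoint k a b s).1 v + (T.edgePoint k a b (s + 1)).1 v ≠ 0 ↔ v = a ∨ v = b := by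
  have hpos : (0 : ℝ) < 2 ^ k := by positivity
  constructor
  · contrapose!
    rintro ⟨ha, hb⟩
    rw [edgePoint_apply_of_ne h hs.le ha hb, edgePoint_apply_of_ne h hs ha hb, add_zero]
  · rintro (rfl | rfl)
    · rw [edgePoint_apply_left h hs.le, edgePoint_apply_left h hs]
      have : (0 : ℝ) < ((2 ^ k - s : ℕ) : ℝ) := by exact_mod_cast Nat.sub_pos_of_lt hs
      positivity
    · rw [edgePoint_apply_right h hs.le, edgePoint_apply_right h hs]
      positivity

theorem edge_eq_of_edgePoint_edge_eq {a' b' : V} (h : G.Adj a b) (h' : G.Adj a' b') {s s' : ℕ}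
    (hs : s < 2 ^ k) (hs' : s' < 2 ^ k)
    (he : s(T.edgePoint k a b s, T.edgePoint k a b (s + 1))
      = s(T.edgePoint k a' b' s', T.edgePoint k a' b' (s' + 1))) : s(a, b) = s(a', b') := by
  refine Sym2.ext fun v => ?_
  rw [Sym2.mem_iff, Sym2.mem_iff, ← edgePoint_add_apply_ne_zero_iff (T := T) h hs,
    ← edgePoint_add_apply_ne_zero_iff (T := T) h' hs']
  rcases Sym2.eq_iff.1 he with ⟨h1, h2⟩ | ⟨h1, h2⟩
  · rw [h1, h2]
  · rw [h1, h2, add_comm]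

variable (T k) in
/-- The subgraph of the subdivision formed by the sides of the faces of `G`, each of which is a
path of length `2 ^ k`. -/
noncomputable def sideGraph : (T.hexGraph k).Subgraph where
  verts := {p | ∃ a b s, G.Adj a b ∧ s ≤ 2 ^ k ∧ p = T.edgePoint k a b s}
  Adj p q := ∃ a b s, G.Adj a b ∧ s < 2 ^ k ∧ p = T.edgePoint k a b s ∧
    q = T.edgePoint k a b (s + 1)
  adj_sub := by
    rintro p q ⟨a, b, s, h, hs, rfl, rfl⟩
    exact hexGraph_adj_edgePoint h hs
  edge_vert := by
    rintro p q ⟨a, b, s, h, hs, rfl, rfl⟩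
    exact ⟨a, b, s, h, hs.le, rfl⟩
  symm := by
    constructor
    rintro p q ⟨a, b, s, h, hs, rfl, rfl⟩
    refine ⟨b, a, 2 ^ k - (s + 1), h.symm, by omega, (edgePoint_symm hs).symm, ?_⟩
    rw [show 2 ^ k - (s + 1) + 1 = 2 ^ k - s by omega, edgePoint_symm hs.le]

theorem hexCorner_mem_sideGraph (a : V) : T.hexCorner k a ∈ (T.sideGraph k).verts := by
  obtain ⟨b, c, h⟩ := exists_face (T := T) a
  exact ⟨a, b, 0, T.adj_of_face h, Nat.zero_le _, edgePoint_zero.symm⟩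

/-- The path of `sideGraph` along an edge of `G`. -/
theorem exists_walk_sideGraph (h : G.Adj a b) {u v : (T.sideGraph k).verts}
    (hu : u.1 = T.hexCorner k a) (hv : v.1 = T.hexCorner k b) :
    ∃ w : (T.sideGraph k).coe.Walk u v,
      w.support.map Subtype.val = (List.range (2 ^ k + 1)).map (T.edgePoint k a b) ∧
      ∀ e : Sym2 (T.sideGraph k).verts, e ∈ w.edges ↔ ∃ s < 2 ^ k,
        e.map Subtype.val = s(T.edgePoint k a b s, T.edgePoint k a b (s + 1)) := by
  -- the index is truncated so that the sequence is defined on all of `ℕ`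
  let p : ℕ → (T.sideGraph k).verts := fun i =>
    ⟨T.edgePoint k a b (min i (2 ^ k)), a, b, min i (2 ^ k), h, min_le_right _ _, rfl⟩
  have hp : ∀ i ≤ 2 ^ k, (p i).1 = T.edgePoint k a b i := fun i hi => by
    simp only [p, min_eq_left hi]
  obtain ⟨w, h1, h2⟩ := SimpleGraph.exists_walk_of_forall_adj (H := (T.sideGraph k).coe) p (2 ^ k)
    (fun i hi => ⟨a, b, i, h, hi, hp i hi.le, hp (i + 1) hi⟩)
    (Subtype.ext ((hp 0 (Nat.zero_le _)).trans (edgePoint_zero.trans hu.symm)))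
    (Subtype.ext ((hp _ le_rfl).trans (edgePoint_two_pow.trans hv.symm)))
  refine ⟨w, ?_, fun e => ?_⟩
  · rw [h1, List.map_map]
    refine List.map_congr_left fun i hi => hp i ?_
    have := List.mem_range.1 hi
    omega
  · rw [h2, List.mem_map]
    constructor
    · rintro ⟨s, hs, rfl⟩
      have hs := List.mem_range.1 hs
      exact ⟨s, hs, by rw [Sym2.map_mk, hp s hs.le, hp (s + 1) hs]⟩
    · rintro ⟨s, hs, he⟩
      refine ⟨s, List.mem_range.2 hs, Sym2.map.injective Subtype.val_injective ?_⟩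
      rw [he, Sym2.map_mk, hp s hs.le, hp (s + 1) hs]

variable (T k) in
theorem exists_graphImmersion_sideGraph :
    ∃ I : GraphImmersion G (T.sideGraph k).coe 1 (1 * 2 ^ k),
      ∀ v, (I.vertexMap v).1 = T.hexCorner k v := by
  let π : V ↪ (T.sideGraph k).verts := ⟨fun v => ⟨T.hexCorner k v, hexCorner_mem_sideGraph v⟩,
    fun u v h => hexCorner_injective (congrArg Subtype.val h)⟩
  choose w hsupp hedges using fun d : G.Dart =>
    exists_walk_sideGraph (T := T) (k := k) (u := π d.fst) (v := π d.snd) d.adj rfl rfl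
  have hadj : ∀ e ∈ (T.sideGraph k).coe.edgeSet, ∃ a b, ∃ h : G.Adj a b,
      e ∈ (w ⟨(a, b), h⟩).edges := by
    intro e
    induction e with
    | h p q =>
      rintro ⟨a, b, s, h, hs, hp, hq⟩
      refine ⟨a, b, h, (hedges _ _).2 ⟨s, hs, ?_⟩⟩
      rw [Sym2.map_mk]
      exact congrArg₂ (fun x y => s(x, y)) hp hq
  refine ⟨⟨π, w, fun d => ?_, fun d => ?_, fun d => ?_, fun e _ => ?_, fun e he => ?_,
    fun p => ?_⟩, fun v => rfl⟩
  · rw [SimpleGraph.Walk.isPath_def]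
    refine List.Nodup.of_map Subtype.val ?_
    rw [hsupp d]
    refine List.Nodup.map_on (fun i hi j hj hij => ?_) List.nodup_range
    rw [List.mem_range] at hi hj
    exact edgePoint_injOn d.adj (by omega) (by omega) hij
  · apply SimpleGraph.Walk.ext_support
    refine List.map_injective_iff.2 Subtype.val_injective ?_
    have hrev : (w d).reverse.support.map Subtype.val
        = ((List.range (2 ^ k + 1)).map (T.edgePoint k d.fst d.snd)).reverse := by
      rw [SimpleGraph.Walk.support_reverse, List.map_reverse, hsupp]
    refine (hsupp d.symm).trans (Eq.trans ?_ hrev.symm)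
    refine List.ext_getElem (by simp) fun i hi _ => ?_
    simp only [List.getElem_map, List.getElem_range, List.getElem_reverse, List.length_map,
      List.length_range] at hi ⊢
    rw [← edgePoint_symm (by omega)]
    congr 1
  · have h1 := congrArg List.length (hsupp d)
    simp at h1
    omega
  · rw [Nat.cast_one, Set.encard_le_one_iff]
    rintro _ _ ⟨d, rfl, hd⟩ ⟨d', rfl, hd'⟩
    obtain ⟨s, hs, h1⟩ := (hedges d e).1 hd
    obtain ⟨s', hs', h2⟩ := (hedges d' e).1 hd'
    exact edge_eq_of_edgePoint_edge_eq d.adj d'.adj hs hs' (h1.symm.trans h2)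
  · obtain ⟨a, b, h, hw⟩ := hadj e he
    exact ⟨_, hw⟩
  · obtain ⟨p, a, b, s, h, hs, hp⟩ := p
    refine Or.inr ⟨⟨(a, b), h⟩, ?_⟩
    have h1 : p ∈ (w ⟨(a, b), h⟩).support.map Subtype.val := by
      rw [hsupp, List.mem_map]
      exact ⟨s, List.mem_range.2 (by omega), hp.symm⟩
    obtain ⟨q, hq, rfl⟩ := List.mem_map.1 h1
    exact hq

variable (T k) in
theorem sideGraph_connected : (T.sideGraph k).coe.Connected := by
  let π : V → (T.sideGraph k).verts := fun v => ⟨T.hexCorner k v, hexCorner_mem_sideGraph v⟩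
  obtain ⟨v₀⟩ := T.connected.nonempty
  have : Nonempty (T.sideGraph k).verts := ⟨π v₀⟩
  have hreach : ∀ a b : V, (T.sideGraph k).coe.Reachable (π a) (π b) := by
    intro a b
    obtain ⟨w⟩ := T.connected.preconnected a b
    induction w with
    | nil => exact .refl _
    | cons h _ ih =>
      obtain ⟨w, -, -⟩ := exists_walk_sideGraph (T := T) (k := k) (u := π _) (v := π _) h rfl rfl
      exact w.reachable.trans ih
  have hcorner : ∀ p : (T.sideGraph k).verts, ∃ a, (T.sideGraph k).coe.Reachable (π a) p := by
    rintro ⟨p, a, b, s, h, hs, hp⟩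
    refine ⟨a, ?_⟩
    have key : ∀ s ≤ 2 ^ k, ∀ q : (T.sideGraph k).verts, q.1 = T.edgePoint k a b s →
        (T.sideGraph k).coe.Reachable (π a) q := by
      intro s
      induction s with
      | zero =>
        intro _ q hq
        have : q = π a := Subtype.ext (hq.trans edgePoint_zero)
        rw [this]
      | succ s ih =>
        intro hs q hq
        exact (ih (by omega) ⟨_, a, b, s, h, by omega, rfl⟩ rfl).trans
          (SimpleGraph.Adj.reachable ⟨a, b, s, h, hs, rfl, hq⟩)
    exact key s hs _ hp
  refine ⟨fun p q => ?_⟩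
  obtain ⟨a, ha⟩ := hcorner p
  obtain ⟨b, hb⟩ := hcorner q
  exact ha.symm.trans ((hreach a b).trans hb)

/-- The piecewise linear extension of a function on the vertices of `G`. -/
noncomputable def interpolate [Fintype V] (h : V → ℝ) (p : V → ℝ) : ℝ := ∑ v, p v * h v

theorem interpolate_hexCorner [Fintype V] (h : V → ℝ) (a : V) :
    interpolate h (T.hexCorner k a).1 = h a := by
  rw [interpolate, Finset.sum_eq_single a]
  · rw [hexCorner_apply_self, one_mul]
  · intro b _ hb
    rw [hexCorner_apply_of_ne hb, zero_mul]
  · simp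

theorem interpolate_edgePoint [Fintype V] (h : V → ℝ) (hab : G.Adj a b) {s : ℕ} (hs : s ≤ 2 ^ k) :
    interpolate h (T.edgePoint k a b s).1 = h a + s / 2 ^ k * (h b - h a) := by
  classical
  have hpos : (2 ^ k : ℝ) ≠ 0 := by positivity
  rw [interpolate, ← Finset.sum_subset (Finset.subset_univ {a, b}), Finset.sum_pair hab.ne,
    edgePoint_apply_left hab hs, edgePoint_apply_right hab hs, Nat.cast_sub hs]
  · push_cast
    field_simp
    ring
  · intro v _ hv
    simp only [Finset.mem_insert, Finset.mem_singleton, not_or] at hv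
    rw [edgePoint_apply_of_ne hab hs hv.1 hv.2, zero_mul]

/-- Interpolating linearly along the paths of length `2 ^ k` that replace the edges divides the
Dirichlet energy by `2 ^ k`. -/
theorem dirichletForm_interpolate_le [Fintype V] [Fintype (T.sideGraph k).verts] (h : V → ℝ) :
    dirichletForm (T.sideGraph k).coe (fun p => interpolate h p.1.1)
      (fun p => interpolate h p.1.1) ≤ dirichletForm G h h / 2 ^ k := by
  classical
  have hpos : (0 : ℝ) < 2 ^ k := by positivity
  rw [dirichletForm_self_eq_sum, dirichletForm_self_eq_sum]
  have hex : ∀ p : (T.sideGraph k).verts × (T.sideGraph k).verts,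
      (T.sideGraph k).coe.Adj p.1 p.2 → ∃ t : (V × V) × ℕ, G.Adj t.1.1 t.1.2 ∧ t.2 < 2 ^ k ∧
        p.1.1 = T.edgePoint k t.1.1 t.1.2 t.2 ∧ p.2.1 = T.edgePoint k t.1.1 t.1.2 (t.2 + 1) := by
    rintro p ⟨a, b, s, h1, h2, h3, h4⟩
    exact ⟨⟨⟨a, b⟩, s⟩, h1, h2, h3, h4⟩
  have : Nonempty V := T.connected.nonempty
  choose! e he1 he2 he3 he4 using hex
  calc ∑ p : (T.sideGraph k).verts × (T.sideGraph k).verts with (T.sideGraph k).coe.Adj p.1 p.2,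
        (interpolate h p.1.1.1 - interpolate h p.2.1.1) ^ 2
      = ∑ p : (T.sideGraph k).verts × (T.sideGraph k).verts with (T.sideGraph k).coe.Adj p.1 p.2,
        ((h (e p).1.1 - h (e p).1.2) / 2 ^ k) ^ 2 := by
        refine Finset.sum_congr rfl fun p hp => ?_
        have hp := (Finset.mem_filter.1 hp).2
        rw [he3 p hp, he4 p hp, interpolate_edgePoint h (he1 p hp) (he2 p hp).le,
          interpolate_edgePoint h (he1 p hp) (he2 p hp)]
        congr 1
        push_cast
        field_simp
        ring
    _ = ∑ t ∈ ({p : (T.sideGraph k).verts × (T.sideGraph k).verts |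
          (T.sideGraph k).coe.Adj p.1 p.2} : Finset _).image e,
          ((h t.1.1 - h t.1.2) / 2 ^ k) ^ 2 := by
        rw [Finset.sum_image]
        intro p hp q hq hpq
        have hp := (Finset.mem_filter.1 hp).2
        have hq := (Finset.mem_filter.1 hq).2
        refine Prod.ext (Subtype.ext ?_) (Subtype.ext ?_)
        · rw [he3 p hp, he3 q hq, hpq]
        · rw [he4 p hp, he4 q hq, hpq]
    _ ≤ ∑ t ∈ ({p : V × V | G.Adj p.1 p.2} : Finset _) ×ˢ Finset.range (2 ^ k),
          ((h t.1.1 - h t.1.2) / 2 ^ k) ^ 2 := by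
        refine Finset.sum_le_sum_of_subset_of_nonneg ?_ fun _ _ _ => sq_nonneg _
        intro t ht
        obtain ⟨p, hp, rfl⟩ := Finset.mem_image.1 ht
        have hp := (Finset.mem_filter.1 hp).2
        simp [he1 p hp, he2 p hp]
    _ = _ := by
        rw [Finset.sum_product, Finset.sum_div]
        refine Finset.sum_congr rfl fun p _ => ?_
        simp only [Finset.sum_const, Finset.card_range, nsmul_eq_mul]
        push_cast
        field_simp

end

end SurfaceTriangulation

/-! ### Energy along lattice lines and in triangles -/

/-- Discrete Cauchy–Schwarz inequality along a line. -/
theorem sq_sub_le_mul_sum_sq (u : ℕ → ℝ) {N i j : ℕ} (hi : i ≤ N) (hj : j ≤ N) :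
    (u i - u j) ^ 2 ≤ N * ∑ s ∈ Finset.range N, (u (s + 1) - u s) ^ 2 := by
  wlog hij : i ≤ j generalizing i j
  · rw [← neg_sub, neg_sq]
    exact this hj hi (by omega)
  have h1 : u j - u i = ∑ s ∈ Finset.Ico i j, (u (s + 1) - u s) := by
    rw [Finset.sum_Ico_eq_sub _ hij, Finset.sum_range_sub, Finset.sum_range_sub]
    ring
  rw [← neg_sub, neg_sq, h1]
  refine sq_sum_le_card_mul_sum_sq.trans ?_
  rw [Nat.card_Ico]
  refine mul_le_mul (by exact_mod_cast (by omega : j - i ≤ N)) ?_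
    (Finset.sum_nonneg fun _ _ => sq_nonneg _) (Nat.cast_nonneg _)
  refine Finset.sum_le_sum_of_subset_of_nonneg (fun s hs => ?_) fun _ _ _ => sq_nonneg _
  rw [Finset.mem_Ico] at hs
  exact Finset.mem_range.2 (by omega)

theorem sum_comp_le_sum_of_injOn {ι κ : Type*} {s : Finset ι} {t : Finset κ} {e : ι → κ}
    {g : κ → ℝ} (hinj : Set.InjOn e s) (hmaps : ∀ i ∈ s, e i ∈ t) (hg : ∀ j ∈ t, 0 ≤ g j) :
    ∑ i ∈ s, g (e i) ≤ ∑ j ∈ t, g j := by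
  classical
  rw [← Finset.sum_image hinj]
  exact Finset.sum_le_sum_of_subset_of_nonneg (f := g) (Finset.image_subset_iff.2 hmaps)
    fun j hj _ => hg j hj

theorem sq_mean_sub_mean_le {ι : Type*} (s : Finset ι) (q q' : ι → ℝ) :
    ((∑ i ∈ s, q i) / s.card - (∑ i ∈ s, q' i) / s.card) ^ 2
      ≤ (∑ i ∈ s, (q i - q' i) ^ 2) / s.card := by
  rw [← sub_div, ← Finset.sum_sub_distrib]
  exact sum_div_card_sq_le_sum_sq_div_card

theorem sum_sq_sub_mean_le {ι : Type*} (s : Finset ι) (q : ι → ℝ) :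
    ∑ i ∈ s, (q i - (∑ j ∈ s, q j) / s.card) ^ 2
      ≤ (∑ i ∈ s, ∑ j ∈ s, (q i - q j) ^ 2) / s.card := by
  rw [Finset.sum_div s fun i => ∑ j ∈ s, (q i - q j) ^ 2]
  refine Finset.sum_le_sum fun i hi => ?_
  have hs : (s.card : ℝ) ≠ 0 := by exact_mod_cast (Finset.card_pos.2 ⟨i, hi⟩).ne'
  have h := sq_mean_sub_mean_le s (fun _ => q i) q
  rwa [Finset.sum_const, nsmul_eq_mul, mul_div_cancel_left₀ _ hs] at h

namespace SurfaceTriangulation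

section

variable {V : Type*} {G : SimpleGraph V} {T : SurfaceTriangulation G} {k : ℕ} {a b c d : V}

open Classical in
/-- The Dirichlet energy (over ordered pairs) of the edges of the subdivision whose ends lie in the
closed triangle with corners `a`, `b`, `c`. -/
noncomputable def triangleEnergy [Fintype (T.HexVertex k)] (f : T.HexVertex k → ℝ) (a b c : V) :
    ℝ :=
  ∑ p : T.HexVertex k × T.HexVertex k with (T.hexGraph k).Adj p.1 p.2 ∧
    ∀ v, v ≠ a → v ≠ b → v ≠ c → p.1.1 v = 0 ∧ p.2.1 v = 0, (f p.1 - f p.2) ^ 2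

/-- The energy of `f` along the lattice line of the triangle `a b c` on which the coordinate of `c`
is `z / 2 ^ k`. -/
noncomputable def lineEnergy (f : T.HexVertex k → ℝ) (a b c : V) (z : ℕ) : ℝ :=
  ∑ s ∈ Finset.range (2 ^ k - z),
    (f (T.lat k a b c (2 ^ k - z - (s + 1)) (s + 1) z) - f (T.lat k a b c (2 ^ k - z - s) s z)) ^ 2

theorem lineEnergy_nonneg (f : T.HexVertex k → ℝ) (a b c : V) (z : ℕ) :
    0 ≤ lineEnergy f a b c z :=
  Finset.sum_nonneg fun _ _ => sq_nonneg _

theorem sq_sub_le_lineEnergy (f : T.HexVertex k → ℝ) (a b c : V) {x y x' y' z : ℕ}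
    (h : x + y + z = 2 ^ k) (h' : x' + y' + z = 2 ^ k) :
    (f (T.lat k a b c x y z) - f (T.lat k a b c x' y' z)) ^ 2 ≤ 2 ^ k * lineEnergy f a b c z := by
  have h1 := sq_sub_le_mul_sum_sq (fun s => f (T.lat k a b c (2 ^ k - z - s) s z))
    (N := 2 ^ k - z) (i := y) (j := y') (by omega) (by omega)
  simp only [show 2 ^ k - z - y = x by omega, show 2 ^ k - z - y' = x' by omega] at h1
  refine h1.trans (mul_le_mul_of_nonneg_right ?_ (lineEnergy_nonneg f a b c z))
  exact_mod_cast Nat.sub_le (2 ^ k) z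

variable [Fintype (T.HexVertex k)] (f : T.HexVertex k → ℝ)

theorem triangleEnergy_nonneg (a b c : V) : 0 ≤ triangleEnergy f a b c :=
  Finset.sum_nonneg fun _ _ => sq_nonneg _

theorem triangleEnergy_rotate (a b c : V) : triangleEnergy f a b c = triangleEnergy f b c a := by
  classical
  refine Finset.sum_congr (Finset.filter_congr fun p _ => and_congr_right fun _ =>
    forall_congr' fun v => ?_) fun _ _ => rfl
  tauto

theorem triangleEnergy_swap (a b c : V) : triangleEnergy f a b c = triangleEnergy f b a c := by
  classical
  refine Finset.sum_congr (Finset.filter_congr fun p _ => and_congr_right fun _ =>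
    forall_congr' fun v => ?_) fun _ _ => rfl
  tauto

/-- The lattice lines in one direction are disjoint. -/
theorem sum_lineEnergy_le (h : T.IsTriangle a b c) :
    ∑ z ∈ Finset.range (2 ^ k + 1), lineEnergy f a b c z ≤ triangleEnergy f a b c := by
  classical
  simp only [lineEnergy]
  rw [Finset.sum_sigma', triangleEnergy]
  refine sum_comp_le_sum_of_injOn
    (e := fun t : (_ : ℕ) × ℕ => (T.lat k a b c (2 ^ k - t.1 - (t.2 + 1)) (t.2 + 1) t.1,
      T.lat k a b c (2 ^ k - t.1 - t.2) t.2 t.1))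
    (g := fun p : T.HexVertex k × T.HexVertex k => (f p.1 - f p.2) ^ 2) ?_ ?_
    fun _ _ => sq_nonneg _
  · rintro ⟨z, s⟩ ht ⟨z', s'⟩ ht' he
    simp only [Finset.coe_sigma, Set.mem_sigma_iff, Finset.mem_coe, Finset.mem_range] at ht ht'
    obtain ⟨-, h2, h3⟩ := lat_inj h (by simp only; omega) (by simp only; omega)
      (Prod.ext_iff.1 he).2
    simp only at h2 h3
    subst h2 h3
    rfl
  · rintro ⟨z, s⟩ ht
    simp only [Finset.mem_sigma, Finset.mem_range] at ht
    refine Finset.mem_filter.2 ⟨Finset.mem_univ _, ?_, fun v ha hb hc =>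
      ⟨lat_apply_of_ne h (by simp only; omega) ha hb hc,
        lat_apply_of_ne h (by simp only; omega) ha hb hc⟩⟩
    have := hexGraph_adj_lat h (k := k) (x := 2 ^ k - z - (s + 1)) (y := s) (z := z) (by omega)
    rw [show 2 ^ k - z - (s + 1) + 1 = 2 ^ k - z - s by omega] at this
    exact this.symm

/-! ### Averages over patches -/

variable {m : ℕ}

variable (T k) in
/-- The vertex with index `p` of the patch at the corner `a` of the triangle `a b c`. The patch is
the rhombus formed by the points whose coordinates at `b` and at `c` are less than `m / 2 ^ k`. -/
noncomputable def patchPoint (a b c : V) (p : ℕ × ℕ) : T.HexVertex k :=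
  T.lat k a b c (2 ^ k - p.1 - p.2) p.1 p.2

/-- The mean of `f` over a patch with `m ^ 2` points. -/
noncomputable def patchMean (m : ℕ) (f : T.HexVertex k → ℝ) (a b c : V) : ℝ :=
  (∑ p ∈ Finset.range m ×ˢ Finset.range m, f (T.patchPoint k a b c p)) /
    (Finset.range m ×ˢ Finset.range m).card

omit [Fintype (T.HexVertex k)] in
theorem patchMean_swap (a b c : V) : patchMean m f a b c = patchMean m f a c b := by
  rw [patchMean, patchMean]
  congr 1
  rw [Finset.sum_product, Finset.sum_product_right]
  refine Finset.sum_congr rfl fun i _ => Finset.sum_congr rfl fun j _ => ?_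
  rw [patchPoint, patchPoint, lat_rotate, lat_swap, ← lat_rotate,
    show 2 ^ k - (i, j).1 - (i, j).2 = 2 ^ k - (j, i).1 - (j, i).2 by simp only; omega]

/-- A patch is small enough to stay in its triangle. -/
theorem add_add_eq_of_mem_patch (hm : 4 * m < 2 ^ k + 4) {p : ℕ × ℕ}
    (hp : p ∈ Finset.range m ×ˢ Finset.range m) : 2 ^ k - p.1 - p.2 + p.1 + p.2 = 2 ^ k := by
  rw [Finset.mem_product, Finset.mem_range, Finset.mem_range] at hp
  omega

theorem sum_lineEnergy_snd_le (hm : m ≤ 2 ^ k) (h : T.IsTriangle a b c) :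
    ∑ p ∈ Finset.range m ×ˢ Finset.range m, lineEnergy f a b c p.2
      ≤ m * triangleEnergy f a b c := by
  rw [Finset.sum_product]
  simp only [Finset.sum_const, Finset.card_range, nsmul_eq_mul]
  refine mul_le_mul_of_nonneg_left ?_ (Nat.cast_nonneg _)
  refine le_trans (Finset.sum_le_sum_of_subset_of_nonneg ?_ fun _ _ _ =>
    lineEnergy_nonneg f a b c _) (sum_lineEnergy_le f h)
  intro z hz
  rw [Finset.mem_range] at hz ⊢
  omega

theorem sum_lineEnergy_fst_le (hm : m ≤ 2 ^ k) (h : T.IsTriangle a b c) :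
    ∑ p ∈ Finset.range m ×ˢ Finset.range m, lineEnergy f a b c p.1
      ≤ m * triangleEnergy f a b c := by
  refine le_trans (le_of_eq ?_) (sum_lineEnergy_snd_le f hm h)
  rw [Finset.sum_product, Finset.sum_product_right]

theorem sum_lineEnergy_add_le (hm : 4 * m < 2 ^ k + 4) (h : T.IsTriangle a b c) :
    ∑ p ∈ Finset.range m ×ˢ Finset.range m, lineEnergy f a b c (2 ^ k - p.1 - p.2)
      ≤ m * triangleEnergy f a b c := by
  rw [Finset.sum_product]
  have key : ∀ i ∈ Finset.range m, ∑ j ∈ Finset.range m, lineEnergy f a b c (2 ^ k - i - j)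
      ≤ triangleEnergy f a b c := by
    intro i hi
    rw [Finset.mem_range] at hi
    refine le_trans (sum_comp_le_sum_of_injOn (e := fun j => 2 ^ k - i - j)
      (g := lineEnergy f a b c) ?_ ?_ fun _ _ => lineEnergy_nonneg f a b c _)
      (sum_lineEnergy_le f h)
    · intro j hj j' hj' he
      simp only [Finset.coe_range, Set.mem_Iio] at hj hj' he
      omega
    · intro j hj
      simp only [Finset.mem_range] at hj ⊢
      omega
  refine (Finset.sum_le_sum key).trans ?_
  simp

theorem card_range_product (m : ℕ) :
    (((Finset.range m ×ˢ Finset.range m).card : ℕ) : ℝ) = (m : ℝ) * m := by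
  simp

/-- Comparison of the patches at two corners of a triangle: the patch at `a` is reflected onto the
patch at `b` along lines parallel to `a b`. -/
theorem sq_patchMean_sub_le_of_side (hm0 : 0 < m) (hm : 4 * m < 2 ^ k + 4) (hkm : 2 ^ k ≤ 4 * m)
    (hmk : m ≤ 2 ^ k) (h : T.IsTriangle a b c) :
    (patchMean m f a b c - patchMean m f b a c) ^ 2 ≤ 4 * triangleEnergy f a b c := by
  have hm1 : (0 : ℝ) < m := by exact_mod_cast hm0
  have hkm' : (2 ^ k : ℝ) ≤ 4 * m := by exact_mod_cast hkm
  refine (sq_mean_sub_mean_le _ _ _).trans ?_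
  rw [card_range_product, div_le_iff₀ (by positivity)]
  have h1 : ∑ p ∈ Finset.range m ×ˢ Finset.range m,
      (f (T.patchPoint k a b c p) - f (T.patchPoint k b a c p)) ^ 2
      ≤ 2 ^ k * (m * triangleEnergy f a b c) := by
    refine le_trans (Finset.sum_le_sum fun p hp => ?_)
      (le_of_eq_of_le (Finset.mul_sum _ _ _).symm
        (mul_le_mul_of_nonneg_left (sum_lineEnergy_snd_le f hmk h) (by positivity)))
    have := add_add_eq_of_mem_patch hm hp
    rw [patchPoint, patchPoint, lat_swap b a]
    exact sq_sub_le_lineEnergy f a b c this (by omega)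
  refine h1.trans ?_
  calc 2 ^ k * (m * triangleEnergy f a b c) ≤ 4 * m * (m * triangleEnergy f a b c) :=
        mul_le_mul_of_nonneg_right hkm' (mul_nonneg hm1.le (triangleEnergy_nonneg f a b c))
    _ = _ := by ring

/-- The distance in mean square from a patch to its projection on the side `a c`, along lines
opposite to `a`. -/
theorem sum_sq_patchPoint_sub_side_le (hm : 4 * m < 2 ^ k + 4) (h : T.IsTriangle a b c) :
    ∑ p ∈ Finset.range m ×ˢ Finset.range m,
      (f (T.patchPoint k a b c p) - f (T.lat k c a a (p.1 + p.2) (2 ^ k - p.1 - p.2) 0)) ^ 2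
      ≤ 2 ^ k * (m * triangleEnergy f a b c) := by
  rw [triangleEnergy_rotate]
  refine le_trans (Finset.sum_le_sum fun p hp => ?_)
    (le_of_eq_of_le (Finset.mul_sum _ _ _).symm
      (mul_le_mul_of_nonneg_left (sum_lineEnergy_add_le f hm h.rotate) (by positivity)))
  have := add_add_eq_of_mem_patch hm hp
  rw [patchPoint, lat_rotate, lat_zero_right c a a b, ← lat_rotate b c a]
  exact sq_sub_le_lineEnergy f b c a (by omega) (by omega)

/-- Comparison of the patches at a common corner `a` of two triangles with the common side `a c`:
one patch is reflected onto the other in that side. -/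
theorem sq_patchMean_sub_le_of_reflect (hm0 : 0 < m) (hm : 4 * m < 2 ^ k + 4)
    (hkm : 2 ^ k ≤ 4 * m) (h : T.IsTriangle a b c) (h' : T.IsTriangle a d c) :
    (patchMean m f a b c - patchMean m f a d c) ^ 2
      ≤ 8 * (triangleEnergy f a b c + triangleEnergy f a d c) := by
  have hm1 : (0 : ℝ) < m := by exact_mod_cast hm0
  have hkm' : (2 ^ k : ℝ) ≤ 4 * m := by exact_mod_cast hkm
  refine (sq_mean_sub_mean_le _ _ _).trans ?_
  rw [card_range_product, div_le_iff₀ (by positivity)]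
  have h1 := sum_sq_patchPoint_sub_side_le f hm h
  have h2 := sum_sq_patchPoint_sub_side_le f hm h'
  have h3 : ∑ p ∈ Finset.range m ×ˢ Finset.range m,
      (f (T.patchPoint k a b c p) - f (T.patchPoint k a d c p)) ^ 2
      ≤ 2 * (∑ p ∈ Finset.range m ×ˢ Finset.range m, (f (T.patchPoint k a b c p)
          - f (T.lat k c a a (p.1 + p.2) (2 ^ k - p.1 - p.2) 0)) ^ 2
        + ∑ p ∈ Finset.range m ×ˢ Finset.range m, (f (T.patchPoint k a d c p)
          - f (T.lat k c a a (p.1 + p.2) (2 ^ k - p.1 - p.2) 0)) ^ 2) := by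
    rw [← Finset.sum_add_distrib, Finset.mul_sum]
    refine Finset.sum_le_sum fun p _ => ?_
    set x := f (T.patchPoint k a b c p)
    set y := f (T.patchPoint k a d c p)
    set z := f (T.lat k c a a (p.1 + p.2) (2 ^ k - p.1 - p.2) 0)
    nlinarith [sq_nonneg (x - z + (y - z))]
  have h4 : 0 ≤ m * (triangleEnergy f a b c + triangleEnergy f a d c) :=
    mul_nonneg hm1.le (add_nonneg (triangleEnergy_nonneg f a b c) (triangleEnergy_nonneg f a d c))
  have h5 := mul_le_mul_of_nonneg_right hkm' h4
  nlinarith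

/-- The Poincaré inequality in a patch. -/
theorem sum_sq_patchPoint_sub_patchMean_le (hm0 : 0 < m) (hm : 4 * m < 2 ^ k + 4)
    (hmk : m ≤ 2 ^ k) (h : T.IsTriangle a b c) :
    ∑ p ∈ Finset.range m ×ˢ Finset.range m,
      (f (T.patchPoint k a b c p) - patchMean m f a b c) ^ 2
      ≤ 4 * 4 ^ k * triangleEnergy f a b c := by
  have hm1 : (0 : ℝ) < m := by exact_mod_cast hm0
  have hmk' : (m : ℝ) ≤ 2 ^ k := by exact_mod_cast hmk
  have hE := triangleEnergy_nonneg f a b c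
  set P := Finset.range m ×ˢ Finset.range m with hP
  refine (sum_sq_sub_mean_le _ _).trans ?_
  rw [card_range_product, div_le_iff₀ (by positivity)]
  have hpair : ∀ p ∈ P, ∀ p' ∈ P,
      (f (T.patchPoint k a b c p) - f (T.patchPoint k a b c p')) ^ 2
        ≤ 2 * 2 ^ k * (lineEnergy f a b c p.2 + lineEnergy f c a b p'.1) := by
    intro p hp p' hp'
    have hp'' : (p'.1, p.2) ∈ P := by
      rw [hP, Finset.mem_product] at hp hp' ⊢
      exact ⟨hp'.1, hp.2⟩
    have e := add_add_eq_of_mem_patch hm hp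
    have e' := add_add_eq_of_mem_patch hm hp'
    have e'' := add_add_eq_of_mem_patch hm hp''
    simp only at e''
    have h1 := sq_sub_le_lineEnergy f a b c e e''
    have h2 := sq_sub_le_lineEnergy f c a b (x := p.2) (y := 2 ^ k - p'.1 - p.2) (z := p'.1)
      (x' := p'.2) (y' := 2 ^ k - p'.1 - p'.2) (by omega) (by omega)
    rw [lat_rotate, lat_rotate c a b p'.2] at h2
    rw [patchPoint, patchPoint]
    set x := f (T.lat k a b c (2 ^ k - p.1 - p.2) p.1 p.2)
    set y := f (T.lat k a b c (2 ^ k - p'.1 - p'.2) p'.1 p'.2)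
    set w := f (T.lat k a b c (2 ^ k - p'.1 - p.2) p'.1 p.2)
    nlinarith [sq_nonneg (x - w - (w - y))]
  have hsum : ∑ p ∈ P, ∑ p' ∈ P, 2 * 2 ^ k * (lineEnergy f a b c p.2 + lineEnergy f c a b p'.1)
      = 2 * 2 ^ k * (m * m * (∑ p ∈ P, lineEnergy f a b c p.2 + ∑ p ∈ P, lineEnergy f c a b p.1)) := by
    simp only [← Finset.mul_sum, Finset.sum_add_distrib, Finset.sum_const, nsmul_eq_mul,
      card_range_product, hP]
    ring
  have h1 := sum_lineEnergy_snd_le f hmk h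
  have h2 := sum_lineEnergy_fst_le f hmk h.rotate.rotate
  rw [triangleEnergy_rotate] at h2
  calc ∑ p ∈ P, ∑ p' ∈ P, (f (T.patchPoint k a b c p) - f (T.patchPoint k a b c p')) ^ 2
      ≤ 2 * 2 ^ k * (m * m * (m * triangleEnergy f a b c + m * triangleEnergy f a b c)) := by
        refine (Finset.sum_le_sum fun p hp => Finset.sum_le_sum fun p' hp' =>
          hpair p hp p' hp').trans ?_
        rw [hsum]
        gcongr
    _ = 4 * (2 ^ k * m) * (triangleEnergy f a b c * (m * m)) := by ring
    _ ≤ 4 * (2 ^ k * 2 ^ k) * (triangleEnergy f a b c * (m * m)) := by gcongr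
    _ = _ := by
        rw [← mul_pow]
        norm_num
        ring

/-! ### Turning around a vertex -/

open Classical in
variable (T) in
/-- The third corner of the face to the left of the edge from `a` to `b`. -/
noncomputable def next (a b : V) : V :=
  if h : G.Adj a b then (T.existsUnique_face h).choose else b

omit [Fintype (T.HexVertex k)] in
theorem face_next (h : G.Adj a b) : T.face a b (T.next a b) := by
  rw [next, dif_pos h]
  exact (T.existsUnique_face h).choose_spec.1

omit [Fintype (T.HexVertex k)] in
theorem next_eq (h : T.face a b c) : T.next a b = c :=
  (T.existsUnique_face (T.adj_of_face h)).unique (face_next (T.adj_of_face h)) h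

open Classical in
/-- The energy in the faces around a vertex. -/
noncomputable def starEnergy [Fintype V] (f : T.HexVertex k → ℝ) (a : V) : ℝ :=
  ∑ b with G.Adj a b, triangleEnergy f a b (T.next a b)

theorem triangleEnergy_le_starEnergy [Fintype V] (h : T.face a b c) :
    triangleEnergy f a b c ≤ starEnergy f a := by
  classical
  rw [← next_eq h]
  exact Finset.single_le_sum (f := fun b => triangleEnergy f a b (T.next a b))
    (fun _ _ => triangleEnergy_nonneg f _ _ _) (by simpa using T.adj_of_face h)

theorem starEnergy_nonneg [Fintype V] (a : V) : 0 ≤ starEnergy f a :=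
  Finset.sum_nonneg fun _ _ => triangleEnergy_nonneg f _ _ _

theorem abs_patchMean_sub_next_le [Fintype V] (hm0 : 0 < m) (hm : 4 * m < 2 ^ k + 4)
    (hkm : 2 ^ k ≤ 4 * m) (h : T.face a b c) :
    |patchMean m f a b (T.next a b) - patchMean m f a c (T.next a c)|
      ≤ 4 * √(starEnergy f a) := by
  have hac : G.Adj a c := (T.adj_of_face (T.face_rotate (T.face_rotate h))).symm
  have hd := face_next (T := T) hac
  rw [next_eq h]
  set d := T.next a c
  rw [patchMean_swap f a c d]
  have h1 := sq_patchMean_sub_le_of_reflect f hm0 hm hkm (Or.inl h)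
    (IsTriangle.swap (T := T) (Or.inl hd)).rotate
  have h2 := triangleEnergy_le_starEnergy f h
  have h3 := triangleEnergy_le_starEnergy f hd
  rw [triangleEnergy_rotate, triangleEnergy_swap, ← triangleEnergy_rotate] at h3
  have h4 := Real.abs_le_sqrt (h1.trans (by linarith : _ ≤ 4 ^ 2 * starEnergy f a))
  rwa [Real.sqrt_mul (by norm_num), Real.sqrt_sq (by norm_num)] at h4

/-- The patches at a vertex, in the various faces around it, are compared by turning around it. -/
theorem abs_patchMean_sub_patchMean_le [Fintype V] {D : ℕ} (hD : (G.neighborSet a).ncard ≤ D)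
    (hm0 : 0 < m) (hm : 4 * m < 2 ^ k + 4) (hkm : 2 ^ k ≤ 4 * m) (hb : G.Adj a b)
    (hc : G.Adj a c) :
    |patchMean m f a b (T.next a b) - patchMean m f a c (T.next a c)|
      ≤ D * (4 * √(starEnergy f a)) := by
  classical
  let K : SimpleGraph (G.neighborSet a) := SimpleGraph.fromRel fun x y => T.face a x y
  have hreach : ∀ y, Relation.ReflTransGen (fun x y => T.face a x y) b y →
      ∃ hy : G.Adj a y, K.Reachable ⟨b, hb⟩ ⟨y, hy⟩ := by
    intro y hy
    induction hy with
    | refl => exact ⟨hb, .refl _⟩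
    | @tail x y _ hxy ih =>
      obtain ⟨hx, hr⟩ := ih
      refine ⟨(T.adj_of_face (T.face_rotate (T.face_rotate hxy))).symm,
        hr.trans (SimpleGraph.Adj.reachable ?_)⟩
      rw [SimpleGraph.fromRel_adj]
      exact ⟨fun he => (T.adj_of_face (T.face_rotate hxy)).ne (congrArg Subtype.val he),
        Or.inl hxy⟩
  obtain ⟨hc', hr⟩ := hreach c (T.link_cyclic hb hc)
  have h1 := hr.abs_sub_le (f := fun x => patchMean m f a x.1 (T.next a x.1))
    (s := 4 * √(starEnergy f a)) (by positivity) (by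
      intro x y hxy
      rw [SimpleGraph.fromRel_adj] at hxy
      obtain ⟨-, hxy | hxy⟩ := hxy
      · exact abs_patchMean_sub_next_le f hm0 hm hkm hxy
      · rw [abs_sub_comm]
        exact abs_patchMean_sub_next_le f hm0 hm hkm hxy)
  refine h1.trans (mul_le_mul_of_nonneg_right ?_ (by positivity))
  rw [← Nat.card_eq_fintype_card, Nat.card_coe_set_eq]
  exact_mod_cast hD

variable (T) in
/-- A neighbour of each vertex, which singles out a face at that vertex. -/
noncomputable def someNeighbor (a : V) : V := (exists_face (T := T) a).choose

omit [Fintype (T.HexVertex k)] in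
theorem adj_someNeighbor (a : V) : G.Adj a (T.someNeighbor a) :=
  T.adj_of_face (exists_face (T := T) a).choose_spec.choose_spec

/-- The mean of `f` over the patch at `a` in the face singled out at `a`. -/
noncomputable def vertexMean (m : ℕ) (f : T.HexVertex k → ℝ) (a : V) : ℝ :=
  patchMean m f a (T.someNeighbor a) (T.next a (T.someNeighbor a))

theorem sq_vertexMean_sub_le [Fintype V] {D : ℕ} (hD : ∀ v, (G.neighborSet v).ncard ≤ D)
    (hm0 : 0 < m) (hm : 4 * m < 2 ^ k + 4) (hkm : 2 ^ k ≤ 4 * m) (hmk : m ≤ 2 ^ k)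
    (h : G.Adj a b) :
    (vertexMean m f a - vertexMean m f b) ^ 2
      ≤ 2 * (4 * D + 2) ^ 2 * (starEnergy f a + starEnergy f b) := by
  have hf := face_next (T := T) h
  have hf' := T.face_rotate hf
  set c := T.next a b with hc
  have h1 := abs_patchMean_sub_patchMean_le f (hD a) hm0 hm hkm (adj_someNeighbor (T := T) a) h
  have h2 := abs_patchMean_sub_patchMean_le f (hD b) hm0 hm hkm (adj_someNeighbor (T := T) b)
    (T.adj_of_face hf')
  rw [next_eq hf', patchMean_swap f b c a] at h2
  have h3 : |patchMean m f a b c - patchMean m f b a c| ≤ 2 * √(starEnergy f a) := by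
    have h4 := Real.abs_le_sqrt ((sq_patchMean_sub_le_of_side f hm0 hm hkm hmk (Or.inl hf)).trans
      (by linarith [triangleEnergy_le_starEnergy f hf] : _ ≤ 2 ^ 2 * starEnergy f a))
    rwa [Real.sqrt_mul (by norm_num), Real.sqrt_sq (by norm_num)] at h4
  rw [← hc] at h1
  change |vertexMean m f a - patchMean m f a b c| ≤ _ at h1
  change |vertexMean m f b - patchMean m f b a c| ≤ _ at h2
  rw [abs_sub_comm] at h2
  have h4 : |vertexMean m f a - vertexMean m f b|
      ≤ (4 * D + 2) * (√(starEnergy f a) + √(starEnergy f b)) := by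
    have h5 := abs_add_three (vertexMean m f a - patchMean m f a b c)
      (patchMean m f a b c - patchMean m f b a c) (patchMean m f b a c - vertexMean m f b)
    rw [show vertexMean m f a - patchMean m f a b c + (patchMean m f a b c - patchMean m f b a c)
      + (patchMean m f b a c - vertexMean m f b) = vertexMean m f a - vertexMean m f b by ring] at h5
    nlinarith [Real.sqrt_nonneg (starEnergy f b)]
  have h5 := pow_le_pow_left₀ (abs_nonneg _) h4 2
  rw [sq_abs] at h5
  refine h5.trans ?_
  have h6 := Real.sq_sqrt (starEnergy_nonneg f a)
  have h7 := Real.sq_sqrt (starEnergy_nonneg f b)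
  set x := √(starEnergy f a)
  set y := √(starEnergy f b)
  rw [← h6, ← h7]
  have h8 : 0 ≤ (4 * D + 2 : ℝ) ^ 2 * (x - y) ^ 2 := by positivity
  nlinarith

open Classical in
/-- Every edge of the subdivision lies in boundedly many faces. -/
theorem sum_starEnergy_le [Fintype V] {D : ℕ} (hD : ∀ v, (G.neighborSet v).ncard ≤ D) :
    ∑ a, starEnergy f a ≤ 3 * D * dirichletForm (T.hexGraph k) f f := by
  have h1 : ∑ a, starEnergy f a
      = ∑ t : V × V with G.Adj t.1 t.2, triangleEnergy f t.1 t.2 (T.next t.1 t.2) := by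
    rw [Finset.sum_filter, Fintype.sum_prod_type]
    exact Finset.sum_congr rfl fun a _ => Finset.sum_filter _ _
  have h2 : ∀ t : V × V, triangleEnergy f t.1 t.2 (T.next t.1 t.2)
      = ∑ p : T.HexVertex k × T.HexVertex k with (T.hexGraph k).Adj p.1 p.2,
        if ∀ v, v ≠ t.1 → v ≠ t.2 → v ≠ T.next t.1 t.2 → p.1.1 v = 0 ∧ p.2.1 v = 0 then
          (f p.1 - f p.2) ^ 2 else 0 := by
    intro t
    rw [triangleEnergy, ← Finset.sum_filter, Finset.filter_filter]
    exact Finset.sum_congr (by ext; simp) fun _ _ => rfl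
  rw [h1, Finset.sum_congr rfl fun t _ => h2 t, Finset.sum_comm, dirichletForm_self_eq_sum,
    Finset.mul_sum]
  refine Finset.sum_le_sum fun p _ => ?_
  rw [← Finset.sum_filter, Finset.sum_const, nsmul_eq_mul]
  refine mul_le_mul_of_nonneg_right ?_ (sq_nonneg _)
  obtain ⟨a, ha⟩ := HexVertex.exists_apply_ne_zero T p.1
  let N : Finset V := Finset.univ.filter (G.Adj a)
  have hN : N.card ≤ D := by
    refine le_of_eq_of_le ?_ (hD a)
    rw [Set.ncard_eq_toFinset_card']
    congr 1
    ext; simp [N]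
  have key : ∀ S : Finset (V × V), (∀ t ∈ S, G.Adj t.1 t.2 ∧ ∀ v, v ≠ t.1 → v ≠ t.2 →
      v ≠ T.next t.1 t.2 → p.1.1 v = 0 ∧ p.2.1 v = 0) → S.card ≤ 3 * D := by
    intro S hS
    have hsub : S ⊆ N.image (fun c => (a, c)) ∪ N.image (fun u => (u, a))
        ∪ N.image (fun u => (u, T.next a u)) := by
      rintro ⟨u, c⟩ ht
      obtain ⟨huc, ht⟩ := hS _ ht
      simp only [Finset.mem_union, Finset.mem_image, N, Finset.mem_filter, Finset.mem_univ,
        true_and, Prod.mk.injEq]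
      by_cases h1 : a = u
      · exact Or.inl (Or.inl ⟨c, h1 ▸ huc, h1, rfl⟩)
      by_cases h2 : a = c
      · exact Or.inl (Or.inr ⟨u, h2 ▸ huc.symm, rfl, h2⟩)
      have h3 : a = T.next u c := by
        by_contra h3
        exact ha (ht a h1 h2 h3).1
      have h4 := T.face_rotate (T.face_rotate (face_next (T := T) huc))
      rw [← h3] at h4
      exact Or.inr ⟨u, T.adj_of_face h4, rfl, next_eq h4⟩
    have h3 := (Finset.card_le_card hsub).trans ((Finset.card_union_le _ _).trans
      (Nat.add_le_add_right (Finset.card_union_le _ _) _))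
    have h4 := Finset.card_image_le (s := N) (f := fun c => (a, c))
    have h5 := Finset.card_image_le (s := N) (f := fun u => (u, a))
    have h6 := Finset.card_image_le (s := N) (f := fun u => (u, T.next a u))
    omega
  refine le_of_le_of_eq (Nat.cast_le.2 (key _ fun t ht => ?_)) (by push_cast; rfl)
  rw [Finset.mem_filter, Finset.mem_filter] at ht
  exact ⟨ht.1.2, ht.2⟩

end

end SurfaceTriangulation

section

variable {V : Type*} [Fintype V] {G : SimpleGraph V} {D : ℕ}

open Classical in
theorem sum_sum_adj_add_le (hD : ∀ v, (G.neighborSet v).ncard ≤ D) {g : V → ℝ}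
    (hg : ∀ v, 0 ≤ g v) :
    ∑ x, ∑ y, (if G.Adj x y then g x + g y else 0) ≤ 2 * D * ∑ x, g x := by
  have h1 : ∑ x, ∑ y, (if G.Adj x y then g x else 0) ≤ D * ∑ x, g x := by
    rw [Finset.mul_sum]
    refine Finset.sum_le_sum fun x _ => ?_
    rw [← Finset.sum_filter, Finset.sum_const, nsmul_eq_mul]
    refine mul_le_mul_of_nonneg_right ?_ (hg x)
    have h2 := hD x
    rw [Set.ncard_eq_toFinset_card'] at h2
    refine le_trans (le_of_eq ?_) (Nat.cast_le.2 h2)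
    congr 2
    ext; simp
  have h2 : ∑ x, ∑ y, (if G.Adj x y then g y else 0)
      = ∑ x, ∑ y, (if G.Adj x y then g x else 0) := by
    rw [Finset.sum_comm]
    simp only [G.adj_comm]
  have h3 : ∑ x, ∑ y, (if G.Adj x y then g x + g y else 0)
      = ∑ x, ∑ y, (if G.Adj x y then g x else 0) + ∑ x, ∑ y, (if G.Adj x y then g y else 0) := by
    simp only [← Finset.sum_add_distrib]
    refine Finset.sum_congr rfl fun x _ => Finset.sum_congr rfl fun y _ => ?_
    split_ifs <;> simp
  rw [h3, h2]
  linarith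

theorem dirichletForm_le_of_forall_sq_sub_le (hD : ∀ v, (G.neighborSet v).ncard ≤ D) {g h : V → ℝ}
    (hg : ∀ v, 0 ≤ g v) {M : ℝ} (hM : 0 ≤ M)
    (hh : ∀ x y, G.Adj x y → (h x - h y) ^ 2 ≤ M * (g x + g y)) :
    dirichletForm G h h ≤ 2 * D * M * ∑ x, g x := by
  classical
  calc dirichletForm G h h ≤ ∑ x, ∑ y, M * (if G.Adj x y then g x + g y else 0) := by
        refine Finset.sum_le_sum fun x _ => Finset.sum_le_sum fun y _ => ?_
        split_ifs with hxy
        · rw [← sq]; exact hh x y hxy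
        · simp
    _ ≤ M * (2 * D * ∑ x, g x) := by
        simp only [← Finset.mul_sum]
        exact mul_le_mul_of_nonneg_left (sum_sum_adj_add_le hD hg) hM
    _ = _ := by ring

end

/-! ### Comparison of the eigenvalues -/

namespace SurfaceTriangulation

section

variable {V : Type*} {G : SimpleGraph V} (T : SurfaceTriangulation G) {k m : ℕ}

/-- The vertex with index `p` of the patch at `a` in the face singled out at `a`. -/
noncomputable def patchVertex (k : ℕ) (a : V) (p : ℕ × ℕ) : T.HexVertex k :=
  T.patchPoint k a (T.someNeighbor a) (T.next a (T.someNeighbor a)) p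

theorem isTriangle_someNeighbor (a : V) :
    T.IsTriangle a (T.someNeighbor a) (T.next a (T.someNeighbor a)) :=
  Or.inl (face_next (adj_someNeighbor a))

/-- The patches are disjoint: only the coordinate at `a` of a point of the patch at `a` is at least
`1 / 2`. -/
theorem patchVertex_inj (hm : 4 * m < 2 ^ k + 4) {a a' : V} {p p' : ℕ × ℕ}
    (hp : p ∈ Finset.range m ×ˢ Finset.range m) (hp' : p' ∈ Finset.range m ×ˢ Finset.range m)
    (h : T.patchVertex k a p = T.patchVertex k a' p') : a = a' ∧ p = p' := by
  have e := add_add_eq_of_mem_patch hm hp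
  have e' := add_add_eq_of_mem_patch hm hp'
  have ht := T.isTriangle_someNeighbor a
  have ht' := T.isTriangle_someNeighbor a'
  rw [patchVertex, patchVertex, patchPoint, patchPoint] at h
  rcases eq_or_ne a a' with rfl | hne
  · obtain ⟨-, h1, h2⟩ := lat_inj ht e e' h
    exact ⟨rfl, Prod.ext h1 h2⟩
  exfalso
  have h1 := lat_apply_left ht e
  rw [h] at h1
  rw [Finset.mem_product, Finset.mem_range, Finset.mem_range] at hp hp'
  rcases eq_or_ne a (T.someNeighbor a') with hb | hb
  · have h2 := lat_apply_mid ht' e'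
    rw [← hb] at h1 h2
    have := cast_div_two_pow_inj (h2.symm.trans h1)
    omega
  rcases eq_or_ne a (T.next a' (T.someNeighbor a')) with hc | hc
  · have h2 := lat_apply_right ht' e'
    rw [← hc] at h1 h2
    have := cast_div_two_pow_inj (h2.symm.trans h1)
    omega
  rw [lat_apply_of_ne ht' e' hne hb hc, ← zero_div ((2 : ℝ) ^ k), ← Nat.cast_zero] at h1
  have := cast_div_two_pow_inj h1
  omega

open Classical in
/-- The union of the patches at the vertices in `s`. -/
noncomputable def patchUnion (k m : ℕ) (s : Finset V) : Finset (T.HexVertex k) :=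
  (s ×ˢ (Finset.range m ×ˢ Finset.range m)).image fun t => T.patchVertex k t.1 t.2

theorem sum_patchUnion (hm : 4 * m < 2 ^ k + 4) (s : Finset V) (g : T.HexVertex k → ℝ) :
    ∑ x ∈ T.patchUnion k m s, g x
      = ∑ a ∈ s, ∑ p ∈ Finset.range m ×ˢ Finset.range m, g (T.patchVertex k a p) := by
  classical
  rw [patchUnion, Finset.sum_image, Finset.sum_product]
  rintro ⟨a, p⟩ ht ⟨a', p'⟩ ht' h
  rw [Finset.mem_coe, Finset.mem_product] at ht ht'
  obtain ⟨h1, h2⟩ := T.patchVertex_inj hm ht.2 ht'.2 h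
  exact Prod.ext h1 h2

theorem card_patchUnion (hm : 4 * m < 2 ^ k + 4) (s : Finset V) :
    ((T.patchUnion k m s).card : ℝ) = m * m * s.card := by
  have h := T.sum_patchUnion hm s fun _ => 1
  simp only [Finset.sum_const, nsmul_eq_mul, mul_one, card_range_product] at h
  rw [h]
  ring

variable {T}

theorem sum_patchVertex_eq (hm0 : 0 < m) (f : T.HexVertex k → ℝ) (a : V) :
    ∑ p ∈ Finset.range m ×ˢ Finset.range m, f (T.patchVertex k a p)
      = m * m * vertexMean m f a := by
  have hm1 : (m : ℝ) ≠ 0 := by exact_mod_cast hm0.ne'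
  rw [vertexMean, patchMean, card_range_product]
  simp only [patchVertex]
  field_simp

theorem sum_sq_patchVertex_eq (hm0 : 0 < m) (f : T.HexVertex k → ℝ) (a : V) :
    ∑ p ∈ Finset.range m ×ˢ Finset.range m, f (T.patchVertex k a p) ^ 2
      = m * m * vertexMean m f a ^ 2 + ∑ p ∈ Finset.range m ×ˢ Finset.range m,
        (f (T.patchVertex k a p) - vertexMean m f a) ^ 2 := by
  have h1 : ∀ p, f (T.patchVertex k a p) ^ 2 = 2 * vertexMean m f a * f (T.patchVertex k a p)
      - vertexMean m f a ^ 2 + (f (T.patchVertex k a p) - vertexMean m f a) ^ 2 := fun p => by ring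
  rw [Finset.sum_congr rfl fun p _ => h1 p, Finset.sum_add_distrib, Finset.sum_sub_distrib,
    ← Finset.mul_sum, sum_patchVertex_eq hm0, Finset.sum_const, nsmul_eq_mul, card_range_product]
  ring

theorem sum_sq_sub_vertexMean_le [Fintype V] [Fintype (T.HexVertex k)] {D : ℕ}
    (hD : ∀ v, (G.neighborSet v).ncard ≤ D) (hm0 : 0 < m) (hm : 4 * m < 2 ^ k + 4)
    (hmk : m ≤ 2 ^ k) (f : T.HexVertex k → ℝ) (s : Finset V) :
    ∑ a ∈ s, ∑ p ∈ Finset.range m ×ˢ Finset.range m,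
      (f (T.patchVertex k a p) - vertexMean m f a) ^ 2
      ≤ 12 * D * 4 ^ k * dirichletForm (T.hexGraph k) f f := by
  calc ∑ a ∈ s, ∑ p ∈ Finset.range m ×ˢ Finset.range m,
        (f (T.patchVertex k a p) - vertexMean m f a) ^ 2
      ≤ ∑ a ∈ s, 4 * 4 ^ k * starEnergy f a := by
        refine Finset.sum_le_sum fun a _ => ?_
        refine (sum_sq_patchPoint_sub_patchMean_le f hm0 hm hmk (T.isTriangle_someNeighbor a)).trans
          (mul_le_mul_of_nonneg_left ?_ (by positivity))
        exact triangleEnergy_le_starEnergy f (face_next (adj_someNeighbor a))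
    _ ≤ ∑ a, 4 * 4 ^ k * starEnergy f a :=
        Finset.sum_le_sum_of_subset_of_nonneg (Finset.subset_univ _) fun a _ _ =>
          mul_nonneg (by positivity) (starEnergy_nonneg f a)
    _ ≤ 4 * 4 ^ k * (3 * D * dirichletForm (T.hexGraph k) f f) := by
        rw [← Finset.mul_sum]
        exact mul_le_mul_of_nonneg_left (sum_starEnergy_le f hD) (by positivity)
    _ = _ := by ring

theorem dirichletForm_vertexMean_le [Fintype V] [Fintype (T.HexVertex k)] {D : ℕ}
    (hD : ∀ v, (G.neighborSet v).ncard ≤ D) (hm0 : 0 < m) (hm : 4 * m < 2 ^ k + 4)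
    (hkm : 2 ^ k ≤ 4 * m) (hmk : m ≤ 2 ^ k) (f : T.HexVertex k → ℝ) :
    dirichletForm G (vertexMean m f) (vertexMean m f)
      ≤ 12 * D ^ 2 * (4 * D + 2) ^ 2 * dirichletForm (T.hexGraph k) f f := by
  calc dirichletForm G (vertexMean m f) (vertexMean m f)
      ≤ 2 * D * (2 * (4 * D + 2) ^ 2) * ∑ a, starEnergy f a :=
        dirichletForm_le_of_forall_sq_sub_le hD (starEnergy_nonneg f) (by positivity)
          fun x y hxy => sq_vertexMean_sub_le f hD hm0 hm hkm hmk hxy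
    _ ≤ 2 * D * (2 * (4 * D + 2) ^ 2) * (3 * D * dirichletForm (T.hexGraph k) f f) :=
        mul_le_mul_of_nonneg_left (sum_starEnergy_le f hD) (by positivity)
    _ = _ := by ring

/-- Interpolating a function on the vertices of `G` bounds the second eigenvalue of the subdivided
copy of `G` from above. -/
theorem steklovEigenvalue_sideGraph_mul_le [Fintype V] [Finite (T.sideGraph k).verts] {B : Set V}
    {s : Finset V} (hsB : ∀ v, v ∈ s ↔ v ∈ B) (hs : 1 < s.card)
    {π : V ↪ (T.sideGraph k).verts} (hπ : ∀ v, (π v).1 = T.hexCorner k v) {h : V → ℝ}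
    (h0 : ∑ v ∈ s, h v = 0) :
    2 * steklovEigenvalue (T.sideGraph k).coe (π '' B) 2 * ∑ v ∈ s, h v ^ 2
      ≤ dirichletForm G h h / 2 ^ k := by
  have := Fintype.ofFinite (T.sideGraph k).verts
  obtain ⟨-, -, -, -, hmin⟩ := steklovEigenvalue_two_spec (T.sideGraph_connected k) (π '' B)
    (s := s.map π) (by simp [hsB]) (by rwa [Finset.card_map])
  have hval : ∀ v, interpolate h (π v).1.1 = h v := fun v => by
    rw [hπ, interpolate_hexCorner]
  have h1 := hmin (fun p => interpolate h p.1.1) (by simpa only [Finset.sum_map, hval] using h0)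
  simp only [Finset.sum_map, hval] at h1
  exact h1.trans (dirichletForm_interpolate_le h)

/-- The a priori bound from the test function `δ_u - δ_v`, for two boundary vertices `u`, `v`. -/
theorem steklovEigenvalue_sideGraph_le [Fintype V] [Finite (T.sideGraph k).verts] {D : ℕ}
    (hD : ∀ v, (G.neighborSet v).ncard ≤ D) {B : Set V} {s : Finset V} (hsB : ∀ v, v ∈ s ↔ v ∈ B)
    (hs : 1 < s.card) {π : V ↪ (T.sideGraph k).verts} (hπ : ∀ v, (π v).1 = T.hexCorner k v) :
    steklovEigenvalue (T.sideGraph k).coe (π '' B) 2 ≤ 2 * D / 2 ^ k := by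
  classical
  obtain ⟨u, hu, v, hv, huv⟩ := Finset.one_lt_card.1 hs
  let h : V → ℝ := Pi.single u 1 - Pi.single v 1
  have h0 : ∑ x ∈ s, h x = 0 := by
    simp [h, Finset.sum_sub_distrib, Finset.sum_pi_single', hu, hv]
  have hsq : ∀ x, h x ^ 2 = (Pi.single u 1 + Pi.single v 1 : V → ℝ) x := by
    intro x
    simp only [h, Pi.sub_apply, Pi.add_apply, Pi.single_apply]
    split_ifs with h1 h2 h2
    · exact absurd (h1.symm.trans h2) huv
    all_goals norm_num
  have hs2 : ∑ x ∈ s, h x ^ 2 = 2 := by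
    simp only [hsq, Pi.add_apply, Finset.sum_add_distrib, Finset.sum_pi_single', hu, hv, if_true]
    norm_num
  have hs2' : ∑ x, h x ^ 2 = 2 := by
    simp only [hsq, Pi.add_apply, Finset.sum_add_distrib, Finset.sum_pi_single', Finset.mem_univ,
      if_true]
    norm_num
  have hE : dirichletForm G h h ≤ 2 * D * 2 * ∑ x, h x ^ 2 :=
    dirichletForm_le_of_forall_sq_sub_le hD (fun x => sq_nonneg _) (by norm_num) fun x y _ => by
      nlinarith [sq_nonneg (h x + h y)]
  have h1 := steklovEigenvalue_sideGraph_mul_le hsB hs hπ h0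
  have h2 : dirichletForm G h h / 2 ^ k ≤ 2 * D * 2 * 2 / 2 ^ k := by
    rw [hs2'] at hE
    gcongr
  rw [hs2] at h1
  have h3 : (2 * D * 2 * 2 : ℝ) / 2 ^ k = 4 * (2 * D / 2 ^ k) := by ring
  linarith

/-- If `λ₂` of the subdivision is at most of order `4 ^ (-k)`, its eigenfunction is close to its
mean on each patch, and these means are a test function for the subdivided copy of `G`. Otherwise
the a priori bound suffices. -/
theorem steklovEigenvalue_sideGraph_le_mul [Fintype V] [Finite (T.sideGraph k).verts] {D : ℕ}
    (hD : ∀ v, (G.neighborSet v).ncard ≤ D) (hm0 : 0 < m) (hm : 4 * m < 2 ^ k + 4)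
    (hkm : 2 ^ k ≤ 4 * m) (hmk : m ≤ 2 ^ k) {B : Set V} {s : Finset V}
    (hsB : ∀ v, v ∈ s ↔ v ∈ B) (hs : 1 < s.card) {π : V ↪ (T.sideGraph k).verts}
    (hπ : ∀ v, (π v).1 = T.hexCorner k v) :
    steklovEigenvalue (T.sideGraph k).coe (π '' B) 2
      ≤ (24 * D ^ 2 * (4 * D + 2) ^ 2 + 96 * D ^ 2 + 1) * 2 ^ k *
        steklovEigenvalue (T.hexGraph k) (T.patchUnion k m s) 2 := by
  have := Fintype.ofFinite (T.HexVertex k)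
  have hm1 : (1 : ℝ) ≤ m := by exact_mod_cast hm0
  have hn : (0 : ℝ) < 2 ^ k := by positivity
  have hmn : (m : ℝ) * m ≤ 4 ^ k := by
    rw [show (4 : ℝ) ^ k = 2 ^ k * 2 ^ k by rw [← mul_pow]; norm_num]
    have : (m : ℝ) ≤ 2 ^ k := by exact_mod_cast hmk
    gcongr
  have hcard : 1 < (T.patchUnion k m s).card := by
    have h1 := T.card_patchUnion hm s
    have h2 : (1 : ℝ) < s.card := by exact_mod_cast hs
    have h3 : (1 : ℝ) < (T.patchUnion k m s).card := by
      rw [h1]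
      have h4 : 1 ≤ (m : ℝ) * m := by nlinarith
      nlinarith
    exact_mod_cast h3
  obtain ⟨f, hf0, hf1, hfE, -⟩ := steklovEigenvalue_two_spec (T.hexGraph_connected k)
    (T.patchUnion k m s) (fun x => Finset.mem_coe.symm) hcard
  set μ := steklovEigenvalue (T.hexGraph k) (T.patchUnion k m s) 2
  set ν := steklovEigenvalue (T.sideGraph k).coe (π '' B) 2
  have hμ : 0 ≤ μ := by
    have := dirichletForm_self_nonneg (T.hexGraph k) f
    linarith
  rw [T.sum_patchUnion hm] at hf0 hf1
  have hmean : ∑ a ∈ s, vertexMean m f a = 0 := by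
    simp only [sum_patchVertex_eq hm0, ← Finset.mul_sum] at hf0
    exact (mul_eq_zero.1 hf0).resolve_left (by positivity)
  have hvar := sum_sq_sub_vertexMean_le hD hm0 hm hmk f s
  simp only [sum_sq_patchVertex_eq hm0, Finset.sum_add_distrib, ← Finset.mul_sum] at hf1
  set S := ∑ a ∈ s, vertexMean m f a ^ 2
  have hS : 0 ≤ S := Finset.sum_nonneg fun _ _ => sq_nonneg _
  have hν := steklovEigenvalue_sideGraph_mul_le hsB hs hπ hmean
  change 2 * ν * S ≤ _ at hν
  have hE := dirichletForm_vertexMean_le hD hm0 hm hkm hmk f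
  rw [hfE] at hvar hE
  have h4 : (4 : ℝ) ^ k = 2 ^ k * 2 ^ k := by rw [← mul_pow]; norm_num
  rw [le_div_iff₀ hn] at hν
  have hnμ : 0 ≤ 2 ^ k * μ := by positivity
  rcases le_or_gt (48 * D * 4 ^ k * μ) 1 with hsmall | hlarge
  · have h1 : 1 / 2 ≤ 4 ^ k * S := by nlinarith
    have h2 : ν ≤ 24 * D ^ 2 * (4 * D + 2) ^ 2 * 2 ^ k * μ := by
      by_contra! hlt
      have hν0 : 0 ≤ ν := le_trans (by positivity) hlt.le
      -- multiply the bound for `ν * S` by `2 ^ k` and use the lower bound for `4 ^ k * S`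
      have h3 := mul_le_mul_of_nonneg_left h1 hν0
      have h5 : 2 * (ν * (4 ^ k * S)) ≤ 2 ^ k * (12 * D ^ 2 * (4 * D + 2) ^ 2 * (2 * μ)) := by
        have := mul_le_mul_of_nonneg_left (hν.trans hE) hn.le
        rw [h4]
        linarith
      linarith
    have h6 : 0 ≤ 96 * (D : ℝ) ^ 2 * 2 ^ k * μ := by positivity
    linarith
  · have h1 : ν ≤ 2 * D / 2 ^ k := steklovEigenvalue_sideGraph_le hD hsB hs hπ
    have h2 : (2 * D / 2 ^ k : ℝ) ≤ 96 * D ^ 2 * 2 ^ k * μ := by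
      rw [div_le_iff₀ hn]
      have h3 := mul_le_mul_of_nonneg_left hlarge.le (by positivity : (0 : ℝ) ≤ 2 * D)
      rw [h4] at h3
      linarith
    have h6 : 0 ≤ 24 * (D : ℝ) ^ 2 * (4 * D + 2) ^ 2 * 2 ^ k * μ := by positivity
    linarith

end

end SurfaceTriangulation

theorem mainTheorem3 (D : ℕ) :
    ∃ (c C : ℝ) (ξ L : ℕ), 0 < c ∧
      ∀ (V : Type*) [Finite V] (G : SimpleGraph V) (T : SurfaceTriangulation G)
        (B : Set V) (k : ℕ),
        (∀ v, (G.neighborSet v).ncard ≤ D) → B.Nonempty →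
        ∃ (Bk : Set (T.HexVertex k)) (H : (T.hexGraph k).Subgraph)
          (I : GraphImmersion G H.coe ξ (L * 2 ^ k)),
          c * 4 ^ k * (B.ncard : ℝ) ≤ (Bk.ncard : ℝ) ∧
          (Bk.ncard : ℝ) ≤ C * 4 ^ k * (B.ncard : ℝ) ∧
          (2 ≤ B.ncard →
            steklovEigenvalue H.coe (I.vertexMap '' B) 2 ≤
              C * 2 ^ k * steklovEigenvalue (T.hexGraph k) Bk 2) := by
  refine ⟨1 / 16, 24 * D ^ 2 * (4 * D + 2) ^ 2 + 96 * D ^ 2 + 1, 1, 1, by norm_num, ?_⟩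
  intro V _ G T B k hD _
  have := Fintype.ofFinite V
  -- the patch size: a quarter of the side length, but at least one point
  obtain ⟨m, hm0, hm, hkm, hmk⟩ : ∃ m : ℕ, 0 < m ∧ 4 * m < 2 ^ k + 4 ∧ 2 ^ k ≤ 4 * m ∧
      m ≤ 2 ^ k := by
    have hk : 0 < 2 ^ k := by positivity
    exact ⟨(2 ^ k + 3) / 4, by omega, by omega, by omega, by omega⟩
  obtain ⟨I, hI⟩ := T.exists_graphImmersion_sideGraph k
  have hsB : ∀ v, v ∈ (Set.toFinite B).toFinset ↔ v ∈ B := by simp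
  have hcard : B.ncard = (Set.toFinite B).toFinset.card := Set.ncard_eq_toFinset_card B
  set s := (Set.toFinite B).toFinset
  have h4 : (4 : ℝ) ^ k = 2 ^ k * 2 ^ k := by rw [← mul_pow]; norm_num
  have hkm' : (2 ^ k : ℝ) ≤ 4 * m := by exact_mod_cast hkm
  have hmk' : (m : ℝ) ≤ 2 ^ k := by exact_mod_cast hmk
  refine ⟨T.patchUnion k m s, T.sideGraph k, I, ?_, ?_, fun h2 => ?_⟩
  · rw [Set.ncard_coe_finset, T.card_patchUnion hm, hcard, h4]
    refine mul_le_mul_of_nonneg_right ?_ (Nat.cast_nonneg _)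
    nlinarith [show (0 : ℝ) < 2 ^ k by positivity]
  · rw [Set.ncard_coe_finset, T.card_patchUnion hm, hcard, h4]
    refine mul_le_mul_of_nonneg_right ?_ (Nat.cast_nonneg _)
    have h1 : (m : ℝ) * m ≤ 2 ^ k * 2 ^ k := by gcongr
    have h2 : (0 : ℝ) ≤ 24 * D ^ 2 * (4 * D + 2) ^ 2 + 96 * D ^ 2 := by positivity
    have h3 : (0 : ℝ) ≤ 2 ^ k * 2 ^ k := by positivity
    nlinarith [mul_nonneg h2 h3]
  · exact SurfaceTriangulation.steklovEigenvalue_sideGraph_le_mul hD hm0 hm hkm hmk hsB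
      (hcard ▸ h2) hI
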